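/- Let $$B=\left\{\begin{pmatrix} a&0\\ z&a^{-1}\end{pmatrix} : a\in\mathbb R,\ a>0,\ z\in\mathbb C\right\},$$ a real Lie group whose Lie algebra $\mathfrak b$ consists of the matrices $\begin{pmatrix} u&0\\ w&-u\end{pmatrix}$ with $u\in\mathbb R$, $w\in\mathbb C$. Let $B_{\mathbb R}=\mathbb R\times B\times\mathbb R$ be the groupoid over $\mathbb R$ with source $(x,g,y)\mapsto x$, target $(x,g,y)\mapsto y$ and product $(x,g,y)(y,h,z)=(x,gh,z)$. Write $v\wedge w=v\otimes w-w\otimes v$, and view tangent vectors of $B$ as complex $2\times 2$ matrices. Define a bivector field on $B_{\mathbb R}$ by $\Pi(x,g,y)=\Pi_{x,y}(g)$, where $$\Pi_{x,y}\begin{pmatrix} a&0\\ z&a^{-1}\end{pmatrix}=\begin{pmatrix}0&0\\ iz&0\end{pmatrix}\wedge\begin{pmatrix}-a&0\\0&a^{-1}\end{pmatrix}+\tfrac14\,(xa^2-ya^{-2})\begin{pmatrix}0&0\\ i&0\end{pmatrix}\wedge\begin{pmatrix}0&0\\1&0\end{pmatrix},$$ and put $\{f,g\}=\Pi(df,dg)$.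 Let $\mathfrak B_{\mathbb R}=\mathfrak b\oplus T\mathbb R$ be the direct sum Lie algebroid over $\mathbb R$, with anchor $(v,t)\mapsto t$, and let $\hat J_0=(0,2\,\partial/\partial y)$ and $\hat J_i\in\mathfrak b$ be given by $$2\hat J_1=\begin{pmatrix}-1&0\\0&1\end{pmatrix},\quad 2\hat J_2=\begin{pmatrix}0&0\\ i&0\end{pmatrix},\quad 2\hat J_3=\begin{pmatrix}0&0\\1&0\end{pmatrix}.$$ Let $J_0,\dots,J_3$ be the dual basis. Equip the dual bundle with zero anchor and with the $C^\infty(\mathbb R)$-bilinear bracket for which $J_0$ is central and $[J_1,J_2]=2J_3$, $[J_2,J_3]=2yJ_1+2J_0$, $[J_3,J_1]=2J_2$ over $y\in\mathbb R$. Let $\hat\delta(X)(\xi,\eta)=\langle X,[\xi,\eta]\rangle$ be the corresponding cobracket. Then: 1. $\Pi$ is a Poisson bivector field and $(B_{\mathbb R},\Pi)$ is a Poisson groupoid: $B_{\mathbb R}$ is a Lie groupoid, and the graph of its multiplication is coisotropic in $B_{\mathbb R}\times B_{\mathbb R}\times\overline{B_{\mathbb R}}$, where the last factor carries the opposite Poisson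 structure. 2. $(\mathfrak B_{\mathbb R},\hat\delta)$ is a Lie bialgebroid. Its cobracket $\hat\delta$ is $C^\infty(\mathbb R)$-linear and vanishes on functions, and, with $Y(y)=y$, $$\hat\delta(\hat J_0)=2\hat J_2\wedge\hat J_3,\quad \hat\delta(\hat J_1)=2Y\hat J_2\wedge\hat J_3,\quad \hat\delta(\hat J_2)=2\hat J_3\wedge\hat J_1,\quad \hat\delta(\hat J_3)=2\hat J_1\wedge\hat J_2 .$$ 3. $(\mathfrak B_{\mathbb R},\hat\delta)$ is the Lie bialgebroid associated to $(B_{\mathbb R},\Pi)$. Here the associated Lie algebroid consists of the left invariant vector fields $X$ tangent to the source fibres; its cobracket is $\delta(X)(df,dg)=X\{f,g\}-\{Xf,g\}-\{f,Xg\}$ on such $X$, and vanishes on functions of the target. The isomorphism is complex conjugation $w\mapsto\bar w$ on $\mathfrak b$ (that is, $\hat J_2\mapsto-\hat J_2$, with $\hat J_0,\hat J_1,\hat J_3$ fixed), followed by left translation. Under left translation alone, the associated Lie algebroid is $\mathfrak B_{\mathbb R}$ and the associated cobracket is $-\hat\delta$. -/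

import Mathlib

open scoped Manifold ContDiff Matrix

noncomputable section

namespace ContractionGroupoid

/-! ## Contravariant 2-tensors and bivectors

An element of `V ⊗ V` (`V` finite-dimensional) is encoded by its pairing with two covectors, and
`Λ² V` is embedded in `V ⊗ V` by `v ∧ w = v ⊗ w - w ⊗ v`. -/

section Tensor

variable {V W : Type*} [AddCommGroup V] [Module ℝ V] [TopologicalSpace V]
  [AddCommGroup W] [Module ℝ W] [TopologicalSpace W]

/-- Contravariant 2-tensors on `V`. -/
abbrev Tensor2 (V : Type*) [AddCommGroup V] [Module ℝ V] [TopologicalSpace V] : Type _ :=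
  (V →L[ℝ] ℝ) →ₗ[ℝ] (V →L[ℝ] ℝ) →ₗ[ℝ] ℝ

/-- `P` is antisymmetric, that is, a bivector. -/
def Tensor2.IsBivector (P : Tensor2 V) : Prop := ∀ ξ, P ξ ξ = 0

/-- `v ∧ w = v ⊗ w - w ⊗ v`. -/
def wedge (v w : V) : Tensor2 V :=
  LinearMap.mk₂ ℝ (fun ξ η => ξ v * η w - ξ w * η v)
    (fun _ _ _ => by simp only [add_apply]; ring)
    (fun _ _ _ => by simp only [smul_apply, smul_eq_mul]; ring)
    (fun _ _ _ => by simp only [add_apply]; ring)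
    (fun _ _ _ => by simp only [smul_apply, smul_eq_mul]; ring)

/-- The direct sum `P ⊕ Q` on `V × W`. -/
def Tensor2.prod (P : Tensor2 V) (Q : Tensor2 W) : Tensor2 (V × W) :=
  LinearMap.mk₂ ℝ
    (fun ξ η => P (ξ.comp (ContinuousLinearMap.inl ℝ V W)) (η.comp (ContinuousLinearMap.inl ℝ V W))
      + Q (ξ.comp (ContinuousLinearMap.inr ℝ V W)) (η.comp (ContinuousLinearMap.inr ℝ V W)))
    (fun _ _ _ => by
      simp only [ContinuousLinearMap.add_comp, map_add, LinearMap.add_apply]; ring)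
    (fun _ _ _ => by
      simp only [ContinuousLinearMap.smul_comp, map_smul, LinearMap.smul_apply, smul_eq_mul]; ring)
    (fun _ _ _ => by
      simp only [ContinuousLinearMap.add_comp, map_add]; ring)
    (fun _ _ _ => by
      simp only [ContinuousLinearMap.smul_comp, map_smul, smul_eq_mul]; ring)

end Tensor

/-! ## Poisson manifolds and coisotropic subsets -/

section Poisson

variable {E H M : Type*} [NormedAddCommGroup E] [NormedSpace ℝ E] [TopologicalSpace H]
  (I : ModelWithCorners ℝ E H) [TopologicalSpace M] [ChartedSpace H M]

/-- The differential of a real function, as a covector. -/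
def differential (f : M → ℝ) (p : M) : TangentSpace I p →L[ℝ] ℝ := mfderiv I 𝓘(ℝ, ℝ) f p

/-- A field of contravariant 2-tensors. -/
abbrev TensorField (M : Type*) [TopologicalSpace M] [ChartedSpace H M] : Type _ :=
  ∀ p : M, Tensor2 (TangentSpace I p)

variable {I} in
/-- `{f, g} = P (df, dg)`. -/
def poissonBracket (P : TensorField I M) (f g : M → ℝ) (p : M) : ℝ :=
  P p (differential I f p) (differential I g p)

variable {I} in
/-- `P` is a smooth bivector field whose bracket satisfies the Jacobi identity. -/
structure IsPoisson (P : TensorField I M) : Prop where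
  bivector : ∀ p, (P p).IsBivector
  smooth : ∀ f g : C^∞⟮I, M; ℝ⟯, ContMDiff I 𝓘(ℝ, ℝ) ∞ (poissonBracket P f g)
  jacobi : ∀ (f g h : C^∞⟮I, M; ℝ⟯) (p : M),
    poissonBracket P f (poissonBracket P g h) p + poissonBracket P g (poissonBracket P h f) p
      + poissonBracket P h (poissonBracket P f g) p = 0

/-- `c` is a curve in `M`, smooth near time `0`, with velocity `v` at time `0`. -/
def HasVelocity (c : ℝ → M) (v : TangentSpace I (c 0)) : Prop :=
  ContMDiffAt 𝓘(ℝ, ℝ) I ∞ c 0 ∧ mfderiv 𝓘(ℝ, ℝ) I c 0 (1 : ℝ) = v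

/-- The vectors tangent to a (sub)manifold `S ⊆ M` at `p`: velocities of smooth curves
through `p` lying in `S`. -/
def tangentVectors (S : Set M) (p : M) : Set (TangentSpace I p) :=
  {v | ∃ c : ℝ → M, c 0 = p ∧ (∀ᶠ τ in nhds (0 : ℝ), c τ ∈ S) ∧ HasVelocity I c v}

variable {I} in
/-- `S` is coisotropic: `P` vanishes on the conormal spaces of `S`. -/
def IsCoisotropic (P : TensorField I M) (S : Set M) : Prop :=
  ∀ p ∈ S, ∀ ξ η : TangentSpace I p →L[ℝ] ℝ,
    (∀ v ∈ tangentVectors I S p, ξ v = 0) → (∀ v ∈ tangentVectors I S p, η v = 0) → P p ξ η = 0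

variable {I} in
/-- The bivector field of `M × M × M̄`, where `M̄` is `M` with the opposite bivector field. -/
def tripleField (P : TensorField I M) : TensorField (I.prod (I.prod I)) (M × M × M) :=
  fun p => (P p.1).prod ((P p.2.1).prod (-(P p.2.2)))

variable {I} in
/-- For a vector field `X`, the expression `X {f, g} - {X f, g} - {f, X g}`. -/
def bivectorVariation (P : TensorField I M) (X : ∀ p : M, TangentSpace I p) (f g : M → ℝ)
    (p : M) : ℝ :=
  differential I (poissonBracket P f g) p (X p)
    - poissonBracket P (fun q => differential I f q (X q)) g p
    - poissonBracket P f (fun q => differential I g q (X q)) p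

end Poisson

/-! ## Lie groupoids and Poisson groupoids -/

/-- The structure maps of a groupoid with arrows `G` and objects `O`; `mul f g` is meaningful only
if `tgt f = src g`. -/
structure GroupoidData (G O : Type*) where
  src : G → O
  tgt : G → O
  one : O → G
  inv : G → G
  mul : G → G → G

/-- The axioms of a groupoid. -/
structure GroupoidData.IsGroupoid {G O : Type*} (𝒢 : GroupoidData G O) : Prop where
  src_one : ∀ x, 𝒢.src (𝒢.one x) = x
  tgt_one : ∀ x, 𝒢.tgt (𝒢.one x) = x
  src_inv : ∀ g, 𝒢.src (𝒢.inv g) = 𝒢.tgt g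
  tgt_inv : ∀ g, 𝒢.tgt (𝒢.inv g) = 𝒢.src g
  src_mul : ∀ f g, 𝒢.tgt f = 𝒢.src g → 𝒢.src (𝒢.mul f g) = 𝒢.src f
  tgt_mul : ∀ f g, 𝒢.tgt f = 𝒢.src g → 𝒢.tgt (𝒢.mul f g) = 𝒢.tgt g
  mul_assoc : ∀ f g h, 𝒢.tgt f = 𝒢.src g → 𝒢.tgt g = 𝒢.src h →
    𝒢.mul (𝒢.mul f g) h = 𝒢.mul f (𝒢.mul g h)
  one_mul : ∀ g, 𝒢.mul (𝒢.one (𝒢.src g)) g = g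
  mul_one : ∀ g, 𝒢.mul g (𝒢.one (𝒢.tgt g)) = g
  mul_inv : ∀ g, 𝒢.mul g (𝒢.inv g) = 𝒢.one (𝒢.src g)
  inv_mul : ∀ g, 𝒢.mul (𝒢.inv g) g = 𝒢.one (𝒢.tgt g)

section Groupoid

variable {E H G E' H' O : Type*} [NormedAddCommGroup E] [NormedSpace ℝ E] [TopologicalSpace H]
  (I : ModelWithCorners ℝ E H) [TopologicalSpace G] [ChartedSpace H G]
  [NormedAddCommGroup E'] [NormedSpace ℝ E'] [TopologicalSpace H']
  (J : ModelWithCorners ℝ E' H') [TopologicalSpace O] [ChartedSpace H' O]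

/-- Lie groupoids. -/
structure IsLieGroupoid [IsManifold I ∞ G] [IsManifold J ∞ O] (𝒢 : GroupoidData G O) : Prop where
  isGroupoid : 𝒢.IsGroupoid
  submersion_src : Manifold.IsSubmersion I J ∞ 𝒢.src
  submersion_tgt : Manifold.IsSubmersion I J ∞ 𝒢.tgt
  smooth_one : ContMDiff J I ∞ 𝒢.one
  smooth_inv : ContMDiff I I ∞ 𝒢.inv
  smooth_mul : ContMDiffOn (I.prod I) I ∞ (fun p : G × G => 𝒢.mul p.1 p.2)
    {p | 𝒢.tgt p.1 = 𝒢.src p.2}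

/-- The graph of the multiplication. -/
def GroupoidData.graph (𝒢 : GroupoidData G O) : Set (G × G × G) :=
  {p | 𝒢.tgt p.1 = 𝒢.src p.2.1 ∧ 𝒢.mul p.1 p.2.1 = p.2.2}

/-- Poisson groupoids. The graph of the multiplication of a Lie groupoid is automatically a
submanifold, so that only its coisotropy is a condition. -/
structure IsPoissonGroupoid [IsManifold I ∞ G] [IsManifold J ∞ O] (𝒢 : GroupoidData G O)
    (P : TensorField I G) : Prop where
  isLieGroupoid : IsLieGroupoid I J 𝒢
  isPoisson : IsPoisson P
  coisotropic : IsCoisotropic (tripleField P) 𝒢.graph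

/-- Smooth left invariant vector fields: tangent to the source fibres `s⁻¹(x)`, and preserved by
the left translations `s⁻¹(tgt f) → s⁻¹(src f)`, `g ↦ f g`. -/
structure IsLeftInvariant [IsManifold I ∞ G] (𝒢 : GroupoidData G O) (X : ∀ g : G, TangentSpace I g) : Prop where
  smooth : ContMDiff I I.tangent ∞ (fun g => (⟨g, X g⟩ : TangentBundle I G))
  tangent : ∀ g, mfderiv I J 𝒢.src g (X g) = 0
  invariant : ∀ (f : G) (c : ℝ → G), 𝒢.tgt f = 𝒢.src (c 0) →
    (∀ᶠ τ in nhds (0 : ℝ), 𝒢.src (c τ) = 𝒢.tgt f) → HasVelocity I c (X (c 0)) →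
    HasVelocity I (fun τ => 𝒢.mul f (c τ)) (X (𝒢.mul f (c 0)))

end Groupoid

/-! ## Lie algebroids and Lie bialgebroids on trivialised bundles `O × F → O` -/

section Algebroid

variable {E' H' : Type*} [NormedAddCommGroup E'] [NormedSpace ℝ E'] [TopologicalSpace H']
  (J : ModelWithCorners ℝ E' H') (O : Type*) [TopologicalSpace O] [ChartedSpace H' O]
  (F : Type*) [NormedAddCommGroup F] [NormedSpace ℝ F]

/-- Smooth sections of `O × F → O`. -/
abbrev Sections : Type _ := C^∞⟮J, O; 𝓘(ℝ, F), F⟯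

/-- A constant section. -/
def constSection (v : F) : Sections J O F := ContMDiffMap.const v

/-- An anchor and a bracket on `O × F → O`. -/
structure AlgebroidData where
  anchor : ∀ x : O, F →ₗ[ℝ] TangentSpace J x
  bracket : Sections J O F →ₗ[ℝ] Sections J O F →ₗ[ℝ] Sections J O F

variable {J O F}

/-- Lie algebroids. -/
structure AlgebroidData.IsLieAlgebroid [IsManifold J ∞ O] (A : AlgebroidData J O F) : Prop where
  anchor_smooth : ∀ X : Sections J O F,
    ContMDiff J J.tangent ∞ (fun x => (⟨x, A.anchor x (X x)⟩ : TangentBundle J O))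
  bracket_self : ∀ X, A.bracket X X = 0
  jacobi : ∀ X Y Z, A.bracket X (A.bracket Y Z) + A.bracket Y (A.bracket Z X)
    + A.bracket Z (A.bracket X Y) = 0
  leibniz : ∀ (X Y : Sections J O F) (f : C^∞⟮J, O; ℝ⟯) (x : O),
    A.bracket X (f • Y) x = f x • A.bracket X Y x + differential J f x (A.anchor x (X x)) • Y x

/-- The differential of a section, as a map `T_x O → F`. -/
def sectionDeriv (X : Sections J O F) (x : O) : TangentSpace J x →L[ℝ] F :=
  mfderiv J 𝓘(ℝ, F) X x

/-- The cobracket on `Γ(O × F)` of an algebroid structure `D` on the dual bundle `O × F*`: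
`δ(X)(ξ, η) = ⟨X, [ξ, η]⟩ - ρ_*(ξ)⟨X, η⟩ + ρ_*(η)⟨X, ξ⟩`.
The right hand side is tensorial in the sections `ξ`, `η` if `D` is a Lie algebroid; it is
evaluated here at covectors by extending these to constant sections. -/
def cobracket (D : AlgebroidData J O (F →L[ℝ] ℝ)) (X : Sections J O F) (x : O) : Tensor2 F :=
  LinearMap.mk₂ ℝ
    (fun ξ η => (D.bracket (constSection J O _ ξ) (constSection J O _ η) x) (X x)
      - η (sectionDeriv X x (D.anchor x ξ)) + ξ (sectionDeriv X x (D.anchor x η)))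
    (fun ξ ξ' η => by
      have h : constSection J O _ (ξ + ξ') = constSection J O _ ξ + constSection J O _ ξ' := rfl
      simp only [h, map_add, LinearMap.add_apply, ContMDiffMap.coe_add, Pi.add_apply,
        add_apply]
      ring)
    (fun c ξ η => by
      have h : constSection J O _ (c • ξ) = c • constSection J O _ ξ := rfl
      simp only [h, map_smul, LinearMap.smul_apply, ContMDiffMap.coe_smul, Pi.smul_apply,
        smul_apply, smul_eq_mul]
      ring)
    (fun ξ η η' => by
      have h : constSection J O _ (η + η') = constSection J O _ η + constSection J O _ η' := rfl
      simp only [h, map_add, ContMDiffMap.coe_add, Pi.add_apply,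
        add_apply]
      ring)
    (fun c ξ η => by
      have h : constSection J O _ (c • η) = c • constSection J O _ η := rfl
      simp only [h, map_smul, ContMDiffMap.coe_smul, Pi.smul_apply,
        smul_apply, smul_eq_mul]
      ring)

/-- `v ↦ [X, v](x)`, where `v` is extended to a constant section. -/
def adConst [FiniteDimensional ℝ F] (A : AlgebroidData J O F) (X : Sections J O F) (x : O) :
    F →L[ℝ] F :=
  LinearMap.toContinuousLinearMap
    { toFun := fun v => A.bracket X (constSection J O F v) x
      map_add' := fun v w => by
        have h : constSection J O F (v + w) = constSection J O F v + constSection J O F w := rfl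
        simp only [h, map_add, ContMDiffMap.coe_add, Pi.add_apply]
      map_smul' := fun c v => by
        have h : constSection J O F (c • v) = c • constSection J O F v := rfl
        simp only [h, map_smul, ContMDiffMap.coe_smul, Pi.smul_apply, RingHom.id_apply] }

/-- The Gerstenhaber bracket `[X, P]` of a section `X` of `O × F` and a section `P` of
`O × Λ² F`, paired with `ξ` and `η`: the extension of the bracket of sections by
`[X, f] = ρ(X) f` and `[X, Y ∧ Z] = [X, Y] ∧ Z + Y ∧ [X, Z]`. -/
def gerstenhaber [FiniteDimensional ℝ F] (A : AlgebroidData J O F) (X : Sections J O F)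
    (P : O → Tensor2 F) (x : O) (ξ η : F →L[ℝ] ℝ) : ℝ :=
  differential J (fun x' => P x' ξ η) x (A.anchor x (X x))
    + P x (ξ.comp (adConst A X x)) η + P x ξ (η.comp (adConst A X x))

/-- Lie bialgebroids: Lie algebroid structures `A` on `O × F` and `D` on the dual `O × F*` such that
`δ[X, Y] = [δ X, Y] + [X, δ Y]`, where `[δ X, Y] = -[Y, δ X]`. -/
structure IsLieBialgebroid [IsManifold J ∞ O] [FiniteDimensional ℝ F] (A : AlgebroidData J O F)
    (D : AlgebroidData J O (F →L[ℝ] ℝ)) : Prop where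
  isLieAlgebroid : A.IsLieAlgebroid
  isLieAlgebroid_dual : D.IsLieAlgebroid
  cocycle : ∀ (X Y : Sections J O F) (x : O) (ξ η : F →L[ℝ] ℝ),
    cobracket D (A.bracket X Y) x ξ η
      = -gerstenhaber A Y (cobracket D X) x ξ η + gerstenhaber A X (cobracket D Y) x ξ η

variable {E H G : Type*} [NormedAddCommGroup E] [NormedSpace ℝ E] [TopologicalSpace H]
  {I : ModelWithCorners ℝ E H} [TopologicalSpace G] [ChartedSpace H G]

/-- The vector field on `G` attached to a section of `O × F` by maps `φ g : F → T_g G`. -/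
def translate (𝒢 : GroupoidData G O) (φ : ∀ g : G, F →L[ℝ] TangentSpace I g)
    (X : Sections J O F) (g : G) : TangentSpace I g :=
  φ g (X (𝒢.tgt g))

/-- `A` is identified with the Lie algebroid of the Lie groupoid `𝒢`, which is `ker ds` along the
units with anchor `dt` and the bracket of left invariant vector fields. The identification at the
unit of `x` is `φ (𝒢.one x) : F → ker ds`; at other arrows `φ` is its left translate, so that
`translate 𝒢 φ X` is the left invariant vector field of the section `X`. -/
structure IsLieAlgebroidOf [IsManifold I ∞ G] (𝒢 : GroupoidData G O) (A : AlgebroidData J O F)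
    (φ : ∀ g : G, F →L[ℝ] TangentSpace I g) : Prop where
  injective : ∀ g, Function.Injective (φ g)
  range_eq : ∀ (g : G) (v : TangentSpace I g), (∃ u, φ g u = v) ↔ mfderiv I J 𝒢.src g v = 0
  leftInvariant : ∀ X : Sections J O F, IsLeftInvariant I J 𝒢 (translate 𝒢 φ X)
  anchor_eq : ∀ (g : G) (u : F), mfderiv I J 𝒢.tgt g (φ g u) = A.anchor (𝒢.tgt g) u
  bracket_eq : ∀ (X Y : Sections J O F) (g : G),
    VectorField.mlieBracket I (translate 𝒢 φ X) (translate 𝒢 φ Y) g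
      = translate 𝒢 φ (A.bracket X Y) g

/-- The pair `(A, D)` is identified, through `φ`, with the Lie bialgebroid of the Poisson groupoid
`(𝒢, P)`: moreover `δ(X)(df, dg) = X{f, g} - {X f, g} - {f, X g}` for sections `X`, and
`δ(h)(dg) = {g, h}` for functions `h` on `O` (pulled back by the target map), where
`δ(h)(ξ) = ρ_*(ξ)(h)`. -/
structure IsLieBialgebroidOf [IsManifold I ∞ G] (𝒢 : GroupoidData G O) (P : TensorField I G)
    (A : AlgebroidData J O F) (D : AlgebroidData J O (F →L[ℝ] ℝ))
    (φ : ∀ g : G, F →L[ℝ] TangentSpace I g) : Prop where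
  isLieAlgebroidOf : IsLieAlgebroidOf 𝒢 A φ
  cobracket_eq : ∀ (X : Sections J O F) (f g : C^∞⟮I, G; ℝ⟯) (p : G),
    bivectorVariation P (translate 𝒢 φ X) f g p
      = cobracket D X (𝒢.tgt p) ((differential I f p).comp (φ p)) ((differential I g p).comp (φ p))
  cobracket_fun : ∀ (h : C^∞⟮J, O; ℝ⟯) (g : C^∞⟮I, G; ℝ⟯) (p : G),
    poissonBracket P g (fun q => h (𝒢.tgt q)) p
      = differential J h (𝒢.tgt p) (D.anchor (𝒢.tgt p) ((differential I g p).comp (φ p)))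

end Algebroid

/-! ## The group `B` -/

/-- The matrix with rows `(a, 0)` and `(z, a⁻¹)`. -/
def lowerMatrix (a : ℝ) (z : ℂ) : Matrix (Fin 2) (Fin 2) ℂ := !![(a : ℂ), 0; z, ((a⁻¹ : ℝ) : ℂ)]

theorem lowerMatrix_mul (a b : ℝ) (z w : ℂ) :
    lowerMatrix a z * lowerMatrix b w
      = lowerMatrix (a * b) (z * b + ((a⁻¹ : ℝ) : ℂ) * w) := by
  simp [lowerMatrix, mul_comm]

theorem lowerMatrix_det {a : ℝ} (ha : 0 < a) (z : ℂ) : (lowerMatrix a z).det = 1 := by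
  have : (a : ℂ) ≠ 0 := by exact_mod_cast ha.ne'
  simp [lowerMatrix, Matrix.det_fin_two, this]

/-- The group of lower triangular matrices with rows `(a, 0)` and `(z, a⁻¹)`, with `a > 0` real
and `z` complex. -/
def B : Subgroup (Matrix.SpecialLinearGroup (Fin 2) ℂ) where
  carrier := {g | ∃ (a : ℝ) (z : ℂ), 0 < a ∧ (g : Matrix (Fin 2) (Fin 2) ℂ) = lowerMatrix a z}
  mul_mem' := by
    rintro g h ⟨a, z, ha, hg⟩ ⟨b, w, hb, hh⟩
    exact ⟨a * b, _, mul_pos ha hb, by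
      rw [Matrix.SpecialLinearGroup.coe_mul, hg, hh, lowerMatrix_mul]⟩
  one_mem' := ⟨1, 0, one_pos, by
    ext i j; fin_cases i <;> fin_cases j <;> simp [lowerMatrix]⟩
  inv_mem' := by
    rintro g ⟨a, z, ha, hg⟩
    refine ⟨a⁻¹, -z, inv_pos.2 ha, ?_⟩
    rw [Matrix.SpecialLinearGroup.coe_inv, hg]
    simp [lowerMatrix, Matrix.adjugate_fin_two]

/-- The matrix of an element of `B`. -/
def matrixOf (g : B) : Matrix (Fin 2) (Fin 2) ℂ := (g : Matrix.SpecialLinearGroup (Fin 2) ℂ)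

/-- The linear coordinates `(Re M₀₀, M₁₀)` on complex `2 × 2` matrices `M`. -/
def coord (M : Matrix (Fin 2) (Fin 2) ℂ) : ℝ × ℂ := ((M 0 0).re, M 1 0)

/-- The coordinates `(a, z)` of an element of `B`. -/
def chartMap (g : B) : ℝ × ℂ := coord (matrixOf g)

/-- The element of `B` with coordinates `(a, z)`. -/
def ofCoord (p : {p : ℝ × ℂ // 0 < p.1}) : B :=
  ⟨⟨lowerMatrix p.1.1 p.1.2, lowerMatrix_det p.2 _⟩, _, _, p.2, rfl⟩

theorem matrixOf_eq (g : B) :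
    0 < (chartMap g).1 ∧ matrixOf g = lowerMatrix (chartMap g).1 (chartMap g).2 := by
  obtain ⟨a, z, ha, h⟩ := g.2
  have h' : matrixOf g = lowerMatrix a z := h
  have h1 : chartMap g = (a, z) := by simp [chartMap, coord, h', lowerMatrix]
  rw [h1]
  exact ⟨ha, h'⟩

/-- `B` is homeomorphic to the open set of all `(a, z)` with `a > 0`. -/
def homeo : B ≃ₜ {p : ℝ × ℂ // 0 < p.1} where
  toFun g := ⟨chartMap g, (matrixOf_eq g).1⟩
  invFun := ofCoord
  left_inv g := Subtype.ext (Subtype.ext (matrixOf_eq g).2.symm)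
  right_inv p := by
    apply Subtype.ext
    simp [chartMap, coord, matrixOf, ofCoord, lowerMatrix]
  continuous_toFun := by
    refine Continuous.subtype_mk ?_ _
    have h : Continuous matrixOf := continuous_subtype_val.comp continuous_subtype_val
    exact (Complex.continuous_re.comp (h.matrix_elem 0 0)).prodMk (h.matrix_elem 1 0)
  continuous_invFun := by
    refine Continuous.subtype_mk (Continuous.subtype_mk ?_ _) _
    have ha : Continuous fun p : {p : ℝ × ℂ // 0 < p.1} => p.1.1 :=
      continuous_fst.comp continuous_subtype_val
    have hz : Continuous fun p : {p : ℝ × ℂ // 0 < p.1} => p.1.2 :=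
      continuous_snd.comp continuous_subtype_val
    have hi := ha.inv₀ (fun p => p.2.ne')
    refine continuous_matrix fun i j => ?_
    fin_cases i <;> fin_cases j
    · exact Complex.continuous_ofReal.comp ha
    · exact continuous_const
    · exact hz
    · exact Complex.continuous_ofReal.comp hi

theorem isOpenEmbedding_chartMap : Topology.IsOpenEmbedding chartMap :=
  (IsOpen.isOpenEmbedding_subtypeVal (isOpen_lt continuous_const continuous_fst)).comp
    homeo.isOpenEmbedding

/-- `B` is a manifold with the single chart `(a, z)`. As this chart is the restriction of the linear
map `coord`, a tangent vector of `B` with matrix `M` has coordinates `coord M`. -/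
instance : ChartedSpace (ℝ × ℂ) B := isOpenEmbedding_chartMap.singletonChartedSpace

instance : IsManifold 𝓘(ℝ, ℝ × ℂ) ∞ B :=
  isOpenEmbedding_chartMap.isManifold_singleton (I := 𝓘(ℝ, ℝ × ℂ)) (n := ∞)

/-! ## The groupoid `ℝ × B × ℝ` and its bivector field -/

/-- The arrows `(x, g, y)`. -/
abbrev BR : Type := ℝ × B × ℝ

/-- The model of `ℝ × B × ℝ`. -/
abbrev modelBR : ModelWithCorners ℝ (ℝ × (ℝ × ℂ) × ℝ)
    (ModelProd ℝ (ModelProd (ℝ × ℂ) ℝ)) :=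
  𝓘(ℝ, ℝ).prod (𝓘(ℝ, ℝ × ℂ).prod 𝓘(ℝ, ℝ))

/-- The groupoid with `(x, g, y) (y, h, z) = (x, g h, z)`. -/
def groupoidBR : GroupoidData BR ℝ where
  src p := p.1
  tgt p := p.2.2
  one x := (x, 1, x)
  inv p := (p.2.2, p.2.1⁻¹, p.1)
  mul p q := (p.1, p.2.1 * q.2.1, q.2.2)

/-- The tangent vector `(r, M, t)` of `ℝ × B × ℝ` at `p`, where `M` is the matrix of a tangent
vector of `B`. -/
def tangentBR (p : BR) (r : ℝ) (M : Matrix (Fin 2) (Fin 2) ℂ) (t : ℝ) :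
    TangentSpace modelBR p :=
  (r, coord M, t)

/-- The bivector field. -/
def bivectorBR : TensorField modelBR BR := fun p =>
  let x : ℝ := p.1
  let a : ℝ := (chartMap p.2.1).1
  let z : ℂ := (chartMap p.2.1).2
  let y : ℝ := p.2.2
  wedge (tangentBR p 0 !![0, 0; Complex.I * z, 0] 0)
      (tangentBR p 0 !![-(a : ℂ), 0; 0, ((a⁻¹ : ℝ) : ℂ)] 0)
    + ((1 / 4 : ℝ) * (x * a ^ 2 - y * (a⁻¹) ^ 2)) •
      wedge (tangentBR p 0 !![0, 0; Complex.I, 0] 0) (tangentBR p 0 !![0, 0; 1, 0] 0)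

/-! ## The Lie bialgebroid `𝔟 ⊕ T ℝ` -/

/-- The matrix with rows `(u, 0)` and `(w, -u)`; these matrices form the Lie algebra `𝔟` of `B`,
which is identified with `ℝ × ℂ` in this way. -/
def bMatrix (v : ℝ × ℂ) : Matrix (Fin 2) (Fin 2) ℂ := !![(v.1 : ℂ), 0; v.2, -(v.1 : ℂ)]

/-- The bracket of `𝔟`: the commutator of matrices. -/
def bBracket (v w : ℝ × ℂ) : ℝ × ℂ := coord ⁅bMatrix v, bMatrix w⁆

theorem bMatrix_bBracket (v w : ℝ × ℂ) : bMatrix (bBracket v w) = ⁅bMatrix v, bMatrix w⁆ := by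
  ext i j
  fin_cases i <;> fin_cases j <;>
    simp [bMatrix, bBracket, coord, Ring.lie_def]
  ring

theorem bBracket_eq (v w : ℝ × ℂ) : bBracket v w = (0, (2 * w.1) • v.2 - (2 * v.1) • w.2) := by
  ext <;> simp [bMatrix, bBracket, coord, Ring.lie_def] <;> ring

/-- The fibre of `𝔟 ⊕ T ℝ`: an element of `𝔟` and a multiple of `∂/∂y`. -/
abbrev Fib : Type := (ℝ × ℂ) × ℝ

/-- Sections of `𝔟 ⊕ T ℝ`. -/
abbrev SecBR : Type := Sections 𝓘(ℝ, ℝ) ℝ Fib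

theorem contDiff_bracketFun (X Y : SecBR) : ContDiff ℝ ∞ fun y : ℝ =>
    ((bBracket (X y).1 (Y y).1, 0) : Fib) + (X y).2 • deriv Y y - (Y y).2 • deriv X y := by
  have hX : ContDiff ℝ ∞ X := X.contMDiff.contDiff
  have hY : ContDiff ℝ ∞ Y := Y.contMDiff.contDiff
  have hX' : ContDiff ℝ ∞ (deriv X) := (contDiff_infty_iff_deriv.1 hX).2
  have hY' : ContDiff ℝ ∞ (deriv Y) := (contDiff_infty_iff_deriv.1 hY).2
  simp only [bBracket_eq]
  fun_prop

/-- The bracket of sections of `𝔟 ⊕ T ℝ`. -/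
def bracketBR (X Y : SecBR) : SecBR := ⟨_, (contDiff_bracketFun X Y).contMDiff⟩

theorem bracketBR_apply (X Y : SecBR) (y : ℝ) : bracketBR X Y y =
    ((bBracket (X y).1 (Y y).1, 0) : Fib) + (X y).2 • deriv Y y - (Y y).2 • deriv X y := rfl

theorem deriv_add_section (X Y : SecBR) (y : ℝ) : deriv (⇑X + ⇑Y) y = deriv X y + deriv Y y :=
  deriv_add ((X.contMDiff.contDiff.differentiable (by simp)) y)
    ((Y.contMDiff.contDiff.differentiable (by simp)) y)

theorem deriv_smul_section (c : ℝ) (X : SecBR) (y : ℝ) : deriv (c • ⇑X) y = c • deriv X y :=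
  deriv_const_smul c ((X.contMDiff.contDiff.differentiable (by simp)) y)

/-- The direct sum Lie algebroid `𝔟 ⊕ T ℝ`, with anchor `(v, t) ↦ t`. -/
def algebroidBR : AlgebroidData 𝓘(ℝ, ℝ) ℝ Fib where
  anchor _ := LinearMap.snd ℝ (ℝ × ℂ) ℝ
  bracket := LinearMap.mk₂ ℝ bracketBR
    (fun X X' Y => by
      ext y : 1
      simp only [bracketBR_apply, ContMDiffMap.coe_add, deriv_add_section, Pi.add_apply, bBracket_eq]
      ext <;> simp <;> ring)
    (fun c X Y => by
      ext y : 1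
      simp only [bracketBR_apply, ContMDiffMap.coe_smul, deriv_smul_section, Pi.smul_apply,
        bBracket_eq]
      ext <;> simp <;> ring)
    (fun X Y Y' => by
      ext y : 1
      simp only [bracketBR_apply, ContMDiffMap.coe_add, deriv_add_section, Pi.add_apply, bBracket_eq]
      ext <;> simp <;> ring)
    (fun c X Y => by
      ext y : 1
      simp only [bracketBR_apply, ContMDiffMap.coe_smul, deriv_smul_section, Pi.smul_apply,
        bBracket_eq]
      ext <;> simp <;> ring)

/-- The basis `Ĵ₀, Ĵ₁, Ĵ₂, Ĵ₃` of the fibre of `𝔟 ⊕ T ℝ`: `Ĵ₀` is `2 ∂/∂y`, and `2 Ĵ₁`, `2 Ĵ₂`,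
`2 Ĵ₃` are the matrices with rows `(-1, 0), (0, 1)`, `(0, 0), (i, 0)` and `(0, 0), (1, 0)`. -/
def hatJ : Fin 4 → Fib :=
  ![(0, 2), ((-1 / 2, 0), 0), ((0, Complex.I / 2), 0), ((0, 1 / 2), 0)]

/-- The dual basis `J₀, J₁, J₂, J₃`. -/
def dualJ : Fin 4 → (Fib →L[ℝ] ℝ) :=
  let u : Fib →L[ℝ] ℝ := (ContinuousLinearMap.fst ℝ ℝ ℂ).comp (ContinuousLinearMap.fst ℝ (ℝ × ℂ) ℝ)
  let w : Fib →L[ℝ] ℂ := (ContinuousLinearMap.snd ℝ ℝ ℂ).comp (ContinuousLinearMap.fst ℝ (ℝ × ℂ) ℝ)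
  ![(1 / 2 : ℝ) • ContinuousLinearMap.snd ℝ (ℝ × ℂ) ℝ, (-2 : ℝ) • u,
    (2 : ℝ) • Complex.imCLM.comp w, (2 : ℝ) • Complex.reCLM.comp w]

theorem dualJ_hatJ (i j : Fin 4) : dualJ i (hatJ j) = if i = j then 1 else 0 := by
  fin_cases i <;> fin_cases j <;> simp [dualJ, hatJ] <;> norm_num

/-- The Lie algebra with basis `J₀, …, J₃`, where `J₀` is central and
`[J₁, J₂] = 2 J₃`, `[J₂, J₃] = 2 y J₁ + 2 J₀`, `[J₃, J₁] = 2 J₂`. -/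
def extBracket (y : ℝ) (ξ η : Fib →L[ℝ] ℝ) : Fib →L[ℝ] ℝ :=
  (ξ (hatJ 1) * η (hatJ 2) - ξ (hatJ 2) * η (hatJ 1)) • ((2 : ℝ) • dualJ 3)
    + (ξ (hatJ 2) * η (hatJ 3) - ξ (hatJ 3) * η (hatJ 2)) • ((2 * y) • dualJ 1 + (2 : ℝ) • dualJ 0)
    + (ξ (hatJ 3) * η (hatJ 1) - ξ (hatJ 1) * η (hatJ 3)) • ((2 : ℝ) • dualJ 2)

/-- Sections of the dual of `𝔟 ⊕ T ℝ`. -/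
abbrev DualSecBR : Type := Sections 𝓘(ℝ, ℝ) ℝ (Fib →L[ℝ] ℝ)

theorem contDiff_extBracket (ξ η : DualSecBR) :
    ContDiff ℝ ∞ fun y : ℝ => extBracket y (ξ y) (η y) := by
  have hξ : ContDiff ℝ ∞ ξ := ξ.contMDiff.contDiff
  have hη : ContDiff ℝ ∞ η := η.contMDiff.contDiff
  unfold extBracket
  fun_prop

/-- The bundle of Lie algebras `extBracket y` on the dual of `𝔟 ⊕ T ℝ`, with zero anchor. -/
def dualAlgebroidBR : AlgebroidData 𝓘(ℝ, ℝ) ℝ (Fib →L[ℝ] ℝ) where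
  anchor _ := 0
  bracket := LinearMap.mk₂ ℝ
    (fun ξ η => (⟨_, (contDiff_extBracket ξ η).contMDiff⟩ : DualSecBR))
    (fun ξ ξ' η => by
      ext y : 1
      change extBracket y (ξ y + ξ' y) (η y) = extBracket y (ξ y) (η y) + extBracket y (ξ' y) (η y)
      simp only [extBracket, add_apply]; module)
    (fun c ξ η => by
      ext y : 1
      change extBracket y (c • ξ y) (η y) = c • extBracket y (ξ y) (η y)
      simp only [extBracket, smul_apply, smul_eq_mul]; module)
    (fun ξ η η' => by
      ext y : 1
      change extBracket y (ξ y) (η y + η' y) = extBracket y (ξ y) (η y) + extBracket y (ξ y) (η' y)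
      simp only [extBracket, add_apply]; module)
    (fun c ξ η => by
      ext y : 1
      change extBracket y (ξ y) (c • η y) = c • extBracket y (ξ y) (η y)
      simp only [extBracket, smul_apply, smul_eq_mul]; module)

/-- The cobracket of the Lie bialgebroid `𝔟 ⊕ T ℝ`. -/
abbrev cobracketBR (X : SecBR) (y : ℝ) : Tensor2 Fib := cobracket dualAlgebroidBR X y

/-- The constant sections `Ĵ₀, …, Ĵ₃`. -/
def secJ (i : Fin 4) : SecBR := constSection 𝓘(ℝ, ℝ) ℝ Fib (hatJ i)

/-- Left translation `(v, t) ↦ (0, g v, t)` from the fibre of `𝔟 ⊕ T ℝ` at `y` to the tangent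
space at `(x, g, y)`. -/
def leftFrame (p : BR) : Fib →L[ℝ] TangentSpace modelBR p :=
  LinearMap.toContinuousLinearMap
    { toFun := fun v => tangentBR p 0 (matrixOf p.2.1 * bMatrix v.1) v.2
      map_add' := fun v w => by
        change ((0 : ℝ), coord _, (v + w).2) = ((0 : ℝ) + 0, coord _ + coord _, v.2 + w.2)
        ext <;> simp [coord, bMatrix, Matrix.mul_apply, Fin.sum_univ_two] <;> ring
      map_smul' := fun c v => by
        change ((0 : ℝ), coord _, (c • v).2) = (c • (0 : ℝ), c • coord _, c • v.2)
        ext <;> simp [coord, bMatrix, Matrix.mul_apply, Fin.sum_univ_two] <;> ring }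

/-- Complex conjugation of the off-diagonal entry: the automorphism of `𝔟 ⊕ T ℝ` that fixes `Ĵ₀`,
`Ĵ₁`, `Ĵ₃` and maps `Ĵ₂` to `-Ĵ₂`. -/
def conjFib : Fib →L[ℝ] Fib :=
  ((ContinuousLinearMap.id ℝ ℝ).prodMap (Complex.conjCLE : ℂ →L[ℝ] ℂ)).prodMap
    (ContinuousLinearMap.id ℝ ℝ)

/-- The composition of complex conjugation on `𝔟` with left translation. -/
def conjLeftFrame (p : BR) : Fib →L[ℝ] TangentSpace modelBR p := (leftFrame p).comp conjFib

end ContractionGroupoid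

/-! Since `B` has a single chart, `ℝ × B × ℝ` has global coordinates `(x, (a, z), y)` with `a > 0`,
and in them the chart and its inverse have the identity as differential. Every clause thus becomes a
calculus identity on an open subset of a vector space.

With `z = p + i q` the bivector is `a (p ∂a ∧ ∂q - q ∂a ∧ ∂p) + c ∂q ∧ ∂p`, where `c = (x a² - y
a⁻²) / 4`. It has no component along `x` and `y`, which are therefore Casimirs. The Jacobi identity
(`bracketCoord_jacobi`) concerns only `{a, q} = a p`, `{a, p} = -a q`, `{q, p} = c`: as `c` depends
on `a` and Casimirs alone, `{a, c} = 0`, and the other two terms cancel.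

Coisotropy of the graph amounts to multiplicativity (`bivectorBR_mul`): the field at `g h` is the
right translate by `h` of the field at `g` plus the left translate by `g` of the field at `h`. On
the `z`-plane these translations scale by `b` and by `a⁻¹`, and the coefficients telescope: `b² (x
a² - y a⁻²) + a⁻² (y b² - t b⁻²) = x (a b)² - t (a b)⁻²`.

In the Lie bialgebroid (`isLieBialgebroid_BR`), the central term `2 J₀` of `[J₂, J₃]` compensates
the dependence of `2 y J₁` on the base point.

The Lie derivative of the bivector along the left invariant field of a section is minus the left
translated cobracket (`bracketCoord_variation`). Conjugation on `𝔟` is an automorphism that reverses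
the cobracket (`cobracketBR_conjSection`), which removes the sign. -/

namespace ContractionGroupoid

/-! ### Global coordinates on `ℝ × B × ℝ` -/

/-- The coordinate space of `BR`. -/
abbrev CoordBR : Type := ℝ × (ℝ × ℂ) × ℝ

/-- The global coordinates `(x, (a, z), y)` on `BR`. -/
def coordBR (p : BR) : CoordBR := (p.1, chartMap p.2.1, p.2.2)

/-- The range of the coordinates. -/
def domBR : Set CoordBR := {u | 0 < u.2.1.1}

/-- The inverse of the coordinates (with junk values outside of `domBR`). -/
def arrowBR : CoordBR → BR := (extChartAt modelBR ((0, 1, 0) : BR)).symm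

/-- The chart of `B` does not depend on the base point, so one inverse serves at every arrow. -/
theorem coe_extChartAt_BR_symm (p : BR) :
    ((extChartAt modelBR p).symm : CoordBR → BR) = arrowBR := rfl

theorem extChartAt_BR_target (p : BR) : (extChartAt modelBR p).target = domBR := by
  have h : Set.range chartMap = {q : ℝ × ℂ | 0 < q.1} := by
    ext q
    refine ⟨?_, fun hq => ⟨ofCoord ⟨q, hq⟩, ?_⟩⟩
    · rintro ⟨g, rfl⟩
      exact (matrixOf_eq g).1
    · exact congrArg Subtype.val (homeo.right_inv ⟨q, hq⟩)
  ext u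
  have h1 : u ∈ (extChartAt modelBR p).target ↔ u.2.1 ∈ Set.range chartMap := by
    rw [extChartAt_target, ModelWithCorners.range_eq_univ, Set.inter_univ,
      ← isOpenEmbedding_chartMap.toOpenPartialHomeomorph_target]
    exact ⟨fun hu => hu.2.1, fun hu => ⟨trivial, hu, trivial⟩⟩
  rw [h1, h]
  rfl

theorem extChartAt_BR_source (p : BR) : (extChartAt modelBR p).source = Set.univ := by
  ext u
  simp only [extChartAt_source, Set.mem_univ, iff_true]
  exact ⟨trivial, trivial, trivial⟩

theorem isOpen_domBR : IsOpen domBR := isOpen_lt continuous_const (by fun_prop)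

theorem coordBR_mem (p : BR) : coordBR p ∈ domBR := (matrixOf_eq p.2.1).1

theorem domBR_mem_nhds (p : BR) : domBR ∈ nhds (coordBR p) :=
  isOpen_domBR.mem_nhds (coordBR_mem p)

theorem arrowBR_coordBR (p : BR) : arrowBR (coordBR p) = p :=
  (extChartAt modelBR p).left_inv (by rw [extChartAt_BR_source]; trivial)

theorem coordBR_arrowBR {u : CoordBR} (hu : u ∈ domBR) : coordBR (arrowBR u) = u :=
  (extChartAt modelBR ((0, 1, 0) : BR)).right_inv (by rwa [extChartAt_BR_target])

theorem arrowBR_comp_coordBR_comp {α : Type*} (c : α → BR) : arrowBR ∘ coordBR ∘ c = c :=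
  funext fun τ => arrowBR_coordBR (c τ)

theorem contMDiff_coordBR : ContMDiff modelBR 𝓘(ℝ, CoordBR) ∞ coordBR := by
  intro p
  exact contMDiffAt_extChartAt

theorem contMDiffOn_arrowBR : ContMDiffOn 𝓘(ℝ, CoordBR) modelBR ∞ arrowBR domBR := by
  have := contMDiffOn_extChartAt_symm (I := modelBR) (n := ∞) ((0, 1, 0) : BR)
  rwa [extChartAt_BR_target] at this

theorem continuous_coordBR : Continuous coordBR := contMDiff_coordBR.continuous

/-- Tangent spaces are copies of the model space, read through the preferred chart. That chart is
`coordBR` itself, so the coordinate expression is the identity near the point. -/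
theorem hasMFDerivAt_coordBR (p : BR) :
    HasMFDerivAt modelBR 𝓘(ℝ, CoordBR) coordBR p (ContinuousLinearMap.id ℝ CoordBR) := by
  refine ⟨continuous_coordBR.continuousAt, ?_⟩
  refine HasFDerivAt.hasFDerivWithinAt ?_
  refine (hasFDerivAt_id (𝕜 := ℝ) (coordBR p)).congr_of_eventuallyEq ?_
  filter_upwards [domBR_mem_nhds p] with u hu
  exact coordBR_arrowBR hu

theorem hasMFDerivAt_arrowBR {u : CoordBR} (hu : u ∈ domBR) :
    HasMFDerivAt 𝓘(ℝ, CoordBR) modelBR arrowBR u (ContinuousLinearMap.id ℝ CoordBR) := by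
  refine ⟨contMDiffOn_arrowBR.continuousOn.continuousAt (isOpen_domBR.mem_nhds hu), ?_⟩
  refine HasFDerivAt.hasFDerivWithinAt ?_
  refine (hasFDerivAt_id (𝕜 := ℝ) u).congr_of_eventuallyEq ?_
  filter_upwards [isOpen_domBR.mem_nhds hu] with v hv
  exact coordBR_arrowBR hv

section Functions

variable {F : Type*} [NormedAddCommGroup F] [NormedSpace ℝ F]

theorem contDiffOn_comp_arrowBR {f : BR → F} (hf : ContMDiff modelBR 𝓘(ℝ, F) ∞ f) :
    ContDiffOn ℝ ∞ (f ∘ arrowBR) domBR :=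
  (hf.comp_contMDiffOn contMDiffOn_arrowBR).contDiffOn

theorem contMDiff_comp_coordBR {k : CoordBR → F} (hk : ContDiffOn ℝ ∞ k domBR) :
    ContMDiff modelBR 𝓘(ℝ, F) ∞ (k ∘ coordBR) :=
  hk.contMDiffOn.comp_contMDiff contMDiff_coordBR coordBR_mem

theorem mfderiv_comp_coordBR {k : CoordBR → F} {p : BR}
    (hk : DifferentiableAt ℝ k (coordBR p)) :
    mfderiv modelBR 𝓘(ℝ, F) (k ∘ coordBR) p = fderiv ℝ k (coordBR p) :=
  (hk.hasFDerivAt.hasMFDerivAt.comp p (hasMFDerivAt_coordBR p)).mfderiv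

end Functions

theorem hasVelocity_BR_iff (c : ℝ → BR) (v : CoordBR) :
    HasVelocity modelBR c v ↔ ContDiffAt ℝ ∞ (coordBR ∘ c) 0 ∧ deriv (coordBR ∘ c) 0 = v := by
  have key : ContMDiffAt 𝓘(ℝ, ℝ) modelBR ∞ c 0 →
      mfderiv 𝓘(ℝ, ℝ) modelBR c 0 (1 : ℝ) = deriv (coordBR ∘ c) 0 := fun h => by
    have h1 := ((hasMFDerivAt_coordBR (c 0)).comp (0 : ℝ)
      (h.mdifferentiableAt (by simp)).hasMFDerivAt).mfderiv
    rw [mfderiv_eq_fderiv] at h1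
    rw [← fderiv_apply_one_eq_deriv, h1]
    rfl
  constructor
  · rintro ⟨h, h'⟩
    exact ⟨(contMDiff_coordBR.contMDiffAt.comp 0 h).contDiffAt, (key h).symm.trans h'⟩
  · rintro ⟨h, h'⟩
    have h1 : ContMDiffAt 𝓘(ℝ, ℝ) modelBR ∞ c 0 := by
      have := (contMDiffOn_arrowBR.contMDiffAt (domBR_mem_nhds (c 0))).comp 0 h.contMDiffAt
      rwa [arrowBR_comp_coordBR_comp] at this
    exact ⟨h1, (key h1).trans h'⟩

/-- All trivialisations of the tangent bundle coincide, so smoothness of a vector field is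
smoothness of its components. -/
theorem contMDiff_vectorField_BR {X : ∀ p : BR, TangentSpace modelBR p} {k : CoordBR → CoordBR}
    (hk : ContDiffOn ℝ ∞ k domBR) (hX : ∀ p, X p = k (coordBR p)) :
    ContMDiff modelBR modelBR.tangent ∞ (fun p => (⟨p, X p⟩ : TangentBundle modelBR BR)) := by
  intro p
  rw [Bundle.contMDiffAt_section]
  refine (contMDiff_comp_coordBR hk p).congr_of_eventuallyEq (Filter.Eventually.of_forall ?_)
  intro q
  change (tangentBundleCore modelBR BR).coordChange (achart _ q) (achart _ p) q (X q) = _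
  have h : achart (ModelProd ℝ (ModelProd (ℝ × ℂ) ℝ)) q = achart _ p := rfl
  rw [h]
  exact ((tangentBundleCore modelBR BR).coordChange_self _ _ (mem_achart_source _ q) _).trans (hX q)

/-- The manifold bracket is defined by pulling back along the inverse chart. Its differential is the
identity on `domBR`, so the pulled back fields agree with `k` and `l` near the point. -/
theorem mlieBracket_BR {X Y : ∀ p : BR, TangentSpace modelBR p} {k l : CoordBR → CoordBR}
    (hX : ∀ p, X p = k (coordBR p)) (hY : ∀ p, Y p = l (coordBR p)) (p : BR) :
    VectorField.mlieBracket modelBR X Y p = VectorField.lieBracket ℝ k l (coordBR p) := by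
  have aux : ∀ (Z : ∀ p : BR, TangentSpace modelBR p) (m : CoordBR → CoordBR),
      (∀ p, Z p = m (coordBR p)) →
      VectorField.mpullbackWithin 𝓘(ℝ, CoordBR) modelBR (extChartAt modelBR p).symm Z
        (Set.range modelBR) =ᶠ[nhds (coordBR p)] m := by
    intro Z m hZ
    filter_upwards [domBR_mem_nhds p] with u hu
    have h1 : mfderivWithin 𝓘(ℝ, CoordBR) modelBR (extChartAt modelBR p).symm
        (Set.range modelBR) u = ContinuousLinearMap.id ℝ CoordBR := by
      rw [ModelWithCorners.range_eq_univ, mfderivWithin_univ, coe_extChartAt_BR_symm]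
      exact (hasMFDerivAt_arrowBR hu).mfderiv
    rw [VectorField.mpullbackWithin_apply, h1, coe_extChartAt_BR_symm]
    refine (congrArg (fun L : CoordBR →L[ℝ] CoordBR => L (Z (arrowBR u)))
      (ContinuousLinearMap.inverse_id)).trans ?_
    exact (hZ _).trans (congrArg m (coordBR_arrowBR hu))
  rw [← VectorField.mlieBracketWithin_univ, VectorField.mlieBracketWithin_apply]
  have h2 : mfderiv modelBR 𝓘(ℝ, CoordBR) (extChartAt modelBR p) p
      = ContinuousLinearMap.id ℝ CoordBR := (hasMFDerivAt_coordBR p).mfderiv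
  rw [h2]
  refine (congrArg (fun L : CoordBR →L[ℝ] CoordBR => L _)
    (ContinuousLinearMap.inverse_id)).trans ?_
  rw [Set.preimage_univ, Set.univ_inter, ← VectorField.lieBracketWithin_univ]
  refine (Filter.EventuallyEq.lieBracketWithin_vectorField_eq_of_mem
    ((aux X k hX).filter_mono nhdsWithin_le_nhds) ((aux Y l hY).filter_mono nhdsWithin_le_nhds)
    ?_).trans ?_
  · rw [ModelWithCorners.range_eq_univ]
    trivial
  · rw [ModelWithCorners.range_eq_univ]

/-! ### The Lie groupoid -/

theorem chartMap_mul (g h : B) : chartMap (g * h)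
    = ((chartMap g).1 * (chartMap h).1,
      (chartMap h).1 • (chartMap g).2 + (chartMap g).1⁻¹ • (chartMap h).2) := by
  have h' : chartMap (g * h) = coord (matrixOf g * matrixOf h) := rfl
  rw [h', (matrixOf_eq g).2, (matrixOf_eq h).2, lowerMatrix_mul]
  ext <;> simp [coord, lowerMatrix, mul_comm]

theorem chartMap_inv (g : B) : chartMap g⁻¹ = ((chartMap g).1⁻¹, -(chartMap g).2) := by
  have h : matrixOf g⁻¹ = (matrixOf g).adjugate :=
    Matrix.SpecialLinearGroup.coe_inv (g : Matrix.SpecialLinearGroup (Fin 2) ℂ)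
  have h' : chartMap g⁻¹ = coord (matrixOf g⁻¹) := rfl
  rw [h', h, (matrixOf_eq g).2]
  ext <;> simp [coord, lowerMatrix, Matrix.adjugate_fin_two]

theorem contMDiff_chartMap : ContMDiff 𝓘(ℝ, ℝ × ℂ) 𝓘(ℝ, ℝ × ℂ) ∞ chartMap :=
  contMDiff_isOpenEmbedding (I := 𝓘(ℝ, ℝ × ℂ)) isOpenEmbedding_chartMap

section

variable {E H M : Type*} [NormedAddCommGroup E] [NormedSpace ℝ E] [TopologicalSpace H]
  {I : ModelWithCorners ℝ E H} [TopologicalSpace M] [ChartedSpace H M]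

theorem contMDiff_of_chartMap_comp {f : M → B}
    (hf : ContMDiff I 𝓘(ℝ, ℝ × ℂ) ∞ fun p => chartMap (f p)) :
    ContMDiff I 𝓘(ℝ, ℝ × ℂ) ∞ f :=
  ContMDiff.of_comp_isOpenEmbedding (I' := 𝓘(ℝ, ℝ × ℂ)) isOpenEmbedding_chartMap hf

theorem contMDiff_coords {f : M → B} (hf : ContMDiff I 𝓘(ℝ, ℝ × ℂ) ∞ f) :
    ContMDiff I 𝓘(ℝ, ℝ) ∞ (fun p => (chartMap (f p)).1) ∧
      ContMDiff I 𝓘(ℝ, ℝ) ∞ (fun p => (chartMap (f p)).1⁻¹) ∧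
      ContMDiff I 𝓘(ℝ, ℂ) ∞ (fun p => (chartMap (f p)).2) := by
  have h := contMDiff_chartMap.comp hf
  have h1 : ContMDiff I 𝓘(ℝ, ℝ) ∞ (fun p => (chartMap (f p)).1) :=
    (contDiff_fst (𝕜 := ℝ) (E := ℝ) (F := ℂ) (n := ∞)).contMDiff.comp h
  refine ⟨h1, ?_, (contDiff_snd (𝕜 := ℝ) (E := ℝ) (F := ℂ) (n := ∞)).contMDiff.comp h⟩
  exact fun p => (contDiffAt_inv ℝ (matrixOf_eq (f p)).1.ne').contMDiffAt.comp p (h1 p)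

theorem contMDiff_mul_B {f g : M → B} (hf : ContMDiff I 𝓘(ℝ, ℝ × ℂ) ∞ f)
    (hg : ContMDiff I 𝓘(ℝ, ℝ × ℂ) ∞ g) : ContMDiff I 𝓘(ℝ, ℝ × ℂ) ∞ fun p => f p * g p := by
  refine contMDiff_of_chartMap_comp ?_
  obtain ⟨h1, h2, h3⟩ := contMDiff_coords hf
  obtain ⟨h4, -, h5⟩ := contMDiff_coords hg
  simp only [chartMap_mul]
  exact (h1.mul h4).prodMk_space ((h4.smul h3).add (h2.smul h5))

theorem contMDiff_inv_B {f : M → B} (hf : ContMDiff I 𝓘(ℝ, ℝ × ℂ) ∞ f) :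
    ContMDiff I 𝓘(ℝ, ℝ × ℂ) ∞ fun p => (f p)⁻¹ := by
  refine contMDiff_of_chartMap_comp ?_
  obtain ⟨-, h2, h3⟩ := contMDiff_coords hf
  simp only [chartMap_inv]
  exact h2.prodMk_space h3.neg

end

theorem isGroupoid_BR : groupoidBR.IsGroupoid where
  src_one _ := rfl
  tgt_one _ := rfl
  src_inv _ := rfl
  tgt_inv _ := rfl
  src_mul _ _ _ := rfl
  tgt_mul _ _ _ := rfl
  mul_assoc f g h _ _ := by simp [groupoidBR, mul_assoc]
  one_mul _ := by simp [groupoidBR]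
  mul_one _ := by simp [groupoidBR]
  mul_inv _ := by simp [groupoidBR]
  inv_mul _ := by simp [groupoidBR]

theorem contMDiff_mul_BR : ContMDiff (modelBR.prod modelBR) modelBR ∞
    (fun p : BR × BR => groupoidBR.mul p.1 p.2) :=
  contMDiff_fst.fst.prodMk ((contMDiff_mul_B contMDiff_fst.snd.fst contMDiff_snd.snd.fst).prodMk
    contMDiff_snd.snd.snd)

/-- In the charts such an `f` is a linear isomorphism followed by the first projection, which is the
local normal form of a submersion. -/
theorem isSubmersion_BR (f : BR → ℝ) (hf : Continuous f)
    (e : CoordBR ≃L[ℝ] ℝ × ((ℝ × ℂ) × ℝ)) (he : ∀ p, f p = (e (coordBR p)).1) :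
    Manifold.IsSubmersion modelBR 𝓘(ℝ, ℝ) ∞ f := by
  refine Manifold.IsSubmersionOfComplement.isSubmersion (F := (ℝ × ℂ) × ℝ) fun p => ?_
  refine Manifold.IsSubmersionAtOfComplement.mk_of_continuousAt hf.continuousAt e
    (chartAt _ p) (chartAt _ (f p)) (mem_chart_source _ p) (mem_chart_source _ (f p))
    (IsManifold.chart_mem_maximalAtlas p) (IsManifold.chart_mem_maximalAtlas (f p)) ?_
  intro u hu
  have h1 : u ∈ domBR := by
    rw [← extChartAt_BR_target p]
    exact hu
  refine (he (arrowBR u)).trans ?_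
  rw [coordBR_arrowBR h1]
  rfl

theorem isLieGroupoid_BR : IsLieGroupoid modelBR 𝓘(ℝ, ℝ) groupoidBR where
  isGroupoid := isGroupoid_BR
  submersion_src := isSubmersion_BR _ continuous_fst (ContinuousLinearEquiv.refl ℝ _) fun _ => rfl
  submersion_tgt := isSubmersion_BR _ (continuous_snd.comp continuous_snd)
    -- This composite is the exchange `(x, m, y) ↦ (y, m, x)`.
    (((ContinuousLinearEquiv.refl ℝ ℝ).prodCongr (ContinuousLinearEquiv.prodComm ℝ (ℝ × ℂ) ℝ)).trans
      ((ContinuousLinearEquiv.prodAssoc ℝ ℝ ℝ (ℝ × ℂ)).symm.trans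
        (((ContinuousLinearEquiv.prodComm ℝ ℝ ℝ).prodCongr
          (ContinuousLinearEquiv.refl ℝ (ℝ × ℂ))).trans
        ((ContinuousLinearEquiv.prodAssoc ℝ ℝ ℝ (ℝ × ℂ)).trans
          ((ContinuousLinearEquiv.refl ℝ ℝ).prodCongr (ContinuousLinearEquiv.prodComm ℝ ℝ (ℝ × ℂ)))))))
    fun _ => rfl
  smooth_one := contMDiff_id.prodMk (contMDiff_const.prodMk contMDiff_id)
  smooth_inv := contMDiff_snd.snd.prodMk ((contMDiff_inv_B contMDiff_snd.fst).prodMk contMDiff_fst)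
  smooth_mul := contMDiff_mul_BR.contMDiffOn

/-! ### Coisotropy of the graph of the multiplication -/

/-- The multiplication of `BR` in coordinates. -/
def mulCoord (u v : CoordBR) : CoordBR :=
  (u.1, (u.2.1.1 * v.2.1.1, v.2.1.1 • u.2.1.2 + u.2.1.1⁻¹ • v.2.1.2), v.2.2)

theorem coordBR_mul (f g : BR) :
    coordBR (groupoidBR.mul f g) = mulCoord (coordBR f) (coordBR g) := by
  simp [coordBR, groupoidBR, chartMap_mul, mulCoord]

/-- The differential of `mulCoord`. -/
def mulCoordDeriv (u v d e : CoordBR) : CoordBR :=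
  (d.1, (d.2.1.1 * v.2.1.1 + u.2.1.1 * e.2.1.1,
    v.2.1.1 • d.2.1.2 + e.2.1.1 • u.2.1.2 + u.2.1.1⁻¹ • e.2.1.2
      - (d.2.1.1 / u.2.1.1 ^ 2) • v.2.1.2), e.2.2)

theorem hasDerivAt_mulCoord {u v : ℝ → CoordBR} {d e : CoordBR} {τ : ℝ} (hu : HasDerivAt u d τ)
    (hv : HasDerivAt v e τ) (h0 : (u τ).2.1.1 ≠ 0) :
    HasDerivAt (fun s => mulCoord (u s) (v s)) (mulCoordDeriv (u τ) (v τ) d e) τ := by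
  have ha : HasDerivAt (fun s => (u s).2.1.1) d.2.1.1 τ := by simpa using HasFDerivAt.hasDerivAt hu.snd.fst.fst
  have hz : HasDerivAt (fun s => (u s).2.1.2) d.2.1.2 τ := by simpa using HasFDerivAt.hasDerivAt hu.snd.fst.snd
  have hb : HasDerivAt (fun s => (v s).2.1.1) e.2.1.1 τ := by simpa using HasFDerivAt.hasDerivAt hv.snd.fst.fst
  have hw : HasDerivAt (fun s => (v s).2.1.2) e.2.1.2 τ := by simpa using HasFDerivAt.hasDerivAt hv.snd.fst.snd
  have hx : HasDerivAt (fun s => (u s).1) d.1 τ := by simpa using HasFDerivAt.hasDerivAt hu.fst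
  have hy : HasDerivAt (fun s => (v s).2.2) e.2.2 τ := by simpa using HasFDerivAt.hasDerivAt hv.snd.snd
  have h := hx.prodMk (((ha.mul hb).prodMk ((hb.smul hz).add ((ha.inv h0).smul hw))).prodMk hy)
  refine h.congr_deriv ?_
  ext <;> simp [mulCoordDeriv]
  all_goals ring

theorem contDiffAt_mulCoord {u v : ℝ → CoordBR} {τ : ℝ} (hu : ContDiffAt ℝ ∞ u τ)
    (hv : ContDiffAt ℝ ∞ v τ) (h0 : (u τ).2.1.1 ≠ 0) :
    ContDiffAt ℝ ∞ (fun s => mulCoord (u s) (v s)) τ := by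
  unfold mulCoord
  fun_prop (disch := exact h0)

theorem eventually_line_mem_domBR (p : BR) (d : CoordBR) :
    ∀ᶠ τ : ℝ in nhds 0, coordBR p + τ • d ∈ domBR := by
  have h : Filter.Tendsto (fun τ : ℝ => coordBR p + τ • d) (nhds 0) (nhds (coordBR p)) := by
    have h' : Continuous fun τ : ℝ => coordBR p + τ • d := by fun_prop
    simpa using h'.tendsto 0
  exact h (domBR_mem_nhds p)

/-- A straight line from a point of the open set `domBR` stays there for small times, so the junk
values of `arrowBR` do not affect velocities. -/
theorem coordBR_arrowBR_line (p : BR) (d : CoordBR) :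
    coordBR ∘ (fun τ : ℝ => arrowBR (coordBR p + τ • d)) =ᶠ[nhds 0]
      fun τ => coordBR p + τ • d := by
  filter_upwards [eventually_line_mem_domBR p d] with τ hτ using coordBR_arrowBR hτ

theorem hasDerivAt_line (u d : CoordBR) (τ : ℝ) : HasDerivAt (fun τ : ℝ => u + τ • d) d τ := by
  simpa using ((hasDerivAt_id τ).smul_const d).const_add u

/-- A curve through `p` with velocity `d`. -/
def lineBR (p : BR) (d : CoordBR) (τ : ℝ) : BR := arrowBR (coordBR p + τ • d)

theorem lineBR_zero (p : BR) (d : CoordBR) : lineBR p d 0 = p := by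
  simp [lineBR, arrowBR_coordBR]

theorem contDiffAt_lineBR (p : BR) (d : CoordBR) :
    ContDiffAt ℝ ∞ (coordBR ∘ lineBR p d) 0 :=
  ContDiffAt.congr_of_eventuallyEq (by fun_prop) (coordBR_arrowBR_line p d)

theorem hasDerivAt_lineBR (p : BR) (d : CoordBR) :
    HasDerivAt (coordBR ∘ lineBR p d) d 0 :=
  (hasDerivAt_line _ _ _).congr_of_eventuallyEq (coordBR_arrowBR_line p d)

theorem hasVelocity_mul {c e : ℝ → BR} {d d' : CoordBR} (hc : ContDiffAt ℝ ∞ (coordBR ∘ c) 0)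
    (hc' : HasDerivAt (coordBR ∘ c) d 0) (he : ContDiffAt ℝ ∞ (coordBR ∘ e) 0)
    (he' : HasDerivAt (coordBR ∘ e) d' 0) :
    HasVelocity modelBR (fun τ => groupoidBR.mul (c τ) (e τ))
      (mulCoordDeriv (coordBR (c 0)) (coordBR (e 0)) d d') := by
  have h : coordBR ∘ (fun τ => groupoidBR.mul (c τ) (e τ))
      = fun τ => mulCoord ((coordBR ∘ c) τ) ((coordBR ∘ e) τ) :=
    funext fun τ => coordBR_mul _ _
  have h0 : ((coordBR ∘ c) 0).2.1.1 ≠ 0 := (coordBR_mem (c 0)).ne'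
  rw [hasVelocity_BR_iff, h]
  exact ⟨contDiffAt_mulCoord hc he h0, (hasDerivAt_mulCoord hc' he' h0).deriv⟩

theorem HasVelocity.prodMk {E H M E' H' M' : Type*} [NormedAddCommGroup E] [NormedSpace ℝ E]
    [TopologicalSpace H] {I : ModelWithCorners ℝ E H} [TopologicalSpace M] [ChartedSpace H M]
    [NormedAddCommGroup E'] [NormedSpace ℝ E'] [TopologicalSpace H']
    {I' : ModelWithCorners ℝ E' H'} [TopologicalSpace M'] [ChartedSpace H' M']
    {c : ℝ → M} {c' : ℝ → M'} {v : TangentSpace I (c 0)} {v' : TangentSpace I' (c' 0)}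
    (h : HasVelocity I c v) (h' : HasVelocity I' c' v') :
    HasVelocity (I.prod I') (fun τ => (c τ, c' τ))
      ((v, v') : TangentSpace I (c 0) × TangentSpace I' (c' 0)) := by
  refine ⟨h.1.prodMk h'.1, ?_⟩
  have := ((h.1.mdifferentiableAt (by simp)).hasMFDerivAt.prodMk
    (h'.1.mdifferentiableAt (by simp)).hasMFDerivAt).mfderiv
  rw [this]
  exact Prod.ext h.2 h'.2

/-- The graph of the multiplication contains curves with all velocities that its linearised
equations allow. -/
theorem mem_tangentVectors_graph (f g : BR) (hfg : f.2.2 = g.1) (d d' : CoordBR)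
    (hd : d.2.2 = d'.1) :
    ((d, d', mulCoordDeriv (coordBR f) (coordBR g) d d') : CoordBR × CoordBR × CoordBR) ∈
      tangentVectors (modelBR.prod (modelBR.prod modelBR)) groupoidBR.graph
        (f, g, groupoidBR.mul f g) := by
  have h0 := lineBR_zero f d
  have h0' := lineBR_zero g d'
  refine ⟨fun τ => (lineBR f d τ, lineBR g d' τ, groupoidBR.mul (lineBR f d τ) (lineBR g d' τ)),
    by simp only [h0, h0'], ?_, ?_⟩
  · filter_upwards [coordBR_arrowBR_line f d, coordBR_arrowBR_line g d'] with τ h h'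
    refine ⟨?_, rfl⟩
    have h1 : (lineBR f d τ).2.2 = f.2.2 + τ * d.2.2 := congrArg (fun u : CoordBR => u.2.2) h
    have h2 : (lineBR g d' τ).1 = g.1 + τ * d'.1 := congrArg (fun u : CoordBR => u.1) h'
    change (lineBR f d τ).2.2 = (lineBR g d' τ).1
    -- Composability is a linear condition in the coordinates, so it persists along the two straight
    -- lines.
    rw [h1, h2, hfg, hd]
  · have h1 := hasVelocity_mul (contDiffAt_lineBR f d) (hasDerivAt_lineBR f d)
      (contDiffAt_lineBR g d') (hasDerivAt_lineBR g d')
    have h2 : HasVelocity modelBR (lineBR f d) d :=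
      (hasVelocity_BR_iff _ _).2 ⟨contDiffAt_lineBR f d, (hasDerivAt_lineBR f d).deriv⟩
    have h3 : HasVelocity modelBR (lineBR g d') d' :=
      (hasVelocity_BR_iff _ _).2 ⟨contDiffAt_lineBR g d', (hasDerivAt_lineBR g d').deriv⟩
    rw [h0, h0'] at h1
    exact h2.prodMk (h3.prodMk h1)

/-- The bivector field in coordinates. -/
theorem bivectorBR_apply (p : BR) (ξ η : CoordBR →L[ℝ] ℝ) :
    bivectorBR p ξ η =
      ξ (0, (0, Complex.I * (coordBR p).2.1.2), 0) * η (0, (-(coordBR p).2.1.1, 0), 0)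
      - ξ (0, (-(coordBR p).2.1.1, 0), 0) * η (0, (0, Complex.I * (coordBR p).2.1.2), 0)
      + (1 / 4 * ((coordBR p).1 * (coordBR p).2.1.1 ^ 2
          - (coordBR p).2.2 * ((coordBR p).2.1.1)⁻¹ ^ 2)) *
        (ξ (0, (0, Complex.I), 0) * η (0, (0, 1), 0)
          - ξ (0, (0, 1), 0) * η (0, (0, Complex.I), 0)) := by
  simp [bivectorBR, wedge, tangentBR, coord, coordBR]
  rfl

theorem covector_apply (ξ : CoordBR →L[ℝ] ℝ) (a : ℝ) (z : ℂ) :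
    ξ (0, (a, z), 0) = a * ξ (0, (1, 0), 0) + z.re * ξ (0, (0, 1), 0)
      + z.im * ξ (0, (0, Complex.I), 0) := by
  have h : ((0, (a, z), 0) : CoordBR) = a • ((0, (1, 0), 0) : CoordBR)
      + z.re • ((0, (0, 1), 0) : CoordBR) + z.im • ((0, (0, Complex.I), 0) : CoordBR) := by
    ext <;> simp
  rw [h]
  simp only [map_add, map_smul, smul_eq_mul]

/-- The bivector lies in the directions of `B`. A variation of one factor in these directions keeps
the pair composable, so there `ξ₁` and `ξ₂` are determined by `ξ₃` as minus its pullbacks under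
right and left translation. What remains is the multiplicativity of the bivector, a rational
identity in `a`, `b`, `z`, `w`, `x`, `y`, `t`. -/
theorem bivectorBR_mul (f g : BR) (hfg : f.2.2 = g.1) (ξ₁ ξ₂ ξ₃ η₁ η₂ η₃ : CoordBR →L[ℝ] ℝ)
    (hξ : ∀ d d' : CoordBR, d.2.2 = d'.1 →
      ξ₁ d + ξ₂ d' + ξ₃ (mulCoordDeriv (coordBR f) (coordBR g) d d') = 0)
    (hη : ∀ d d' : CoordBR, d.2.2 = d'.1 →
      η₁ d + η₂ d' + η₃ (mulCoordDeriv (coordBR f) (coordBR g) d d') = 0) :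
    bivectorBR f ξ₁ η₁ + bivectorBR g ξ₂ η₂ = bivectorBR (groupoidBR.mul f g) ξ₃ η₃ := by
  have left : ∀ ζ₁ ζ₂ ζ₃ : CoordBR →L[ℝ] ℝ, (∀ d d' : CoordBR, d.2.2 = d'.1 →
      ζ₁ d + ζ₂ d' + ζ₃ (mulCoordDeriv (coordBR f) (coordBR g) d d') = 0) → ∀ m : ℝ × ℂ,
      ζ₁ (0, m, 0) = -ζ₃ (mulCoordDeriv (coordBR f) (coordBR g) (0, m, 0) 0) := by
    intro ζ₁ ζ₂ ζ₃ h m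
    have := h (0, m, 0) 0 rfl
    rw [map_zero] at this
    linarith
  have right : ∀ ζ₁ ζ₂ ζ₃ : CoordBR →L[ℝ] ℝ, (∀ d d' : CoordBR, d.2.2 = d'.1 →
      ζ₁ d + ζ₂ d' + ζ₃ (mulCoordDeriv (coordBR f) (coordBR g) d d') = 0) → ∀ m : ℝ × ℂ,
      ζ₂ (0, m, 0) = -ζ₃ (mulCoordDeriv (coordBR f) (coordBR g) 0 (0, m, 0)) := by
    intro ζ₁ ζ₂ ζ₃ h m
    have := h 0 (0, m, 0) rfl
    rw [map_zero] at this
    linarith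
  have ha : (coordBR f).2.1.1 ≠ 0 := (coordBR_mem f).ne'
  have hb : (coordBR g).2.1.1 ≠ 0 := (coordBR_mem g).ne'
  have hy : (coordBR f).2.2 = (coordBR g).1 := hfg
  simp only [bivectorBR_apply, coordBR_mul, left ξ₁ ξ₂ ξ₃ hξ, left η₁ η₂ η₃ hη,
    right ξ₁ ξ₂ ξ₃ hξ, right η₁ η₂ η₃ hη]
  generalize coordBR f = u at *
  generalize coordBR g = v at *
  obtain ⟨x, ⟨a, z⟩, y⟩ := u
  obtain ⟨y', ⟨b, w⟩, t⟩ := v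
  obtain rfl : y = y' := hy
  simp only at ha hb
  simp only [mulCoordDeriv, mulCoord, Prod.fst_zero, Prod.snd_zero]
  -- The explicit shapes keep `covector_apply` away from the basis vectors on its own right hand
  -- side, where it would loop.
  simp only [covector_apply ξ₃ (_ + _), covector_apply η₃ (_ + _), covector_apply ξ₃ (-_),
    covector_apply η₃ (-_), covector_apply ξ₃ 0 (_ * _), covector_apply η₃ 0 (_ * _)]
  generalize ξ₃ (0, (1, 0), 0) = p₁
  generalize ξ₃ (0, (0, 1), 0) = p₂
  generalize ξ₃ (0, (0, Complex.I), 0) = p₃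
  generalize η₃ (0, (1, 0), 0) = q₁
  generalize η₃ (0, (0, 1), 0) = q₂
  generalize η₃ (0, (0, Complex.I), 0) = q₃
  simp [-Complex.real_smul, Complex.smul_re, Complex.smul_im]
  field_simp
  ring

theorem isCoisotropic_graph_BR : IsCoisotropic (tripleField bivectorBR) groupoidBR.graph := by
  rintro ⟨f, g, k⟩ ⟨hfg, hk⟩ ξ η hξ hη
  obtain rfl : groupoidBR.mul f g = k := hk
  -- A conormal covector kills all tangent vectors of the graph. Only the inclusion given by
  -- `mem_tangentVectors_graph` is needed, not a full description of the tangent space.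
  have key : ∀ ζ : CoordBR × CoordBR × CoordBR →L[ℝ] ℝ,
      (∀ v ∈ tangentVectors (modelBR.prod (modelBR.prod modelBR)) groupoidBR.graph
        (f, g, groupoidBR.mul f g), ζ v = 0) → ∀ d d' : CoordBR, d.2.2 = d'.1 →
      (ζ.comp (.inl ℝ _ _)) d + ((ζ.comp (.inr ℝ _ _)).comp (.inl ℝ _ _)) d'
        + ((ζ.comp (.inr ℝ _ _)).comp (.inr ℝ _ _))
          (mulCoordDeriv (coordBR f) (coordBR g) d d') = 0 := by
    intro ζ h d d' hd
    have := h _ (mem_tangentVectors_graph f g hfg d d' hd)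
    rw [← this]
    simp only [ContinuousLinearMap.comp_apply, ← map_add]
    simp
  have h := bivectorBR_mul f g hfg _ _ _ _ _ _ (key ξ hξ) (key η hη)
  refine Eq.trans (b := bivectorBR f _ _ + (bivectorBR g _ _ + -bivectorBR _ _ _)) rfl ?_
  rw [← add_assoc]
  exact (add_neg_eq_zero).2 h

/-! ### The Poisson bracket in coordinates -/

/-- The coordinate vector `∂/∂a`. -/
def vecA : CoordBR := (0, (1, 0), 0)

/-- The coordinate vector `∂/∂(Re z)`. -/
def vecP : CoordBR := (0, (0, 1), 0)

/-- The coordinate vector `∂/∂(Im z)`. -/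
def vecQ : CoordBR := (0, (0, Complex.I), 0)

/-- The coefficient `(x a² - y a⁻²) / 4`. -/
def coeffBR (u : CoordBR) : ℝ := 1 / 4 * (u.1 * u.2.1.1 ^ 2 - u.2.2 * (u.2.1.1)⁻¹ ^ 2)

/-- The bivector field at the point with coordinates `u`. -/
def bivCoord (u : CoordBR) (ξ η : CoordBR →L[ℝ] ℝ) : ℝ :=
  u.2.1.1 * (u.2.1.2.re * (ξ vecA * η vecQ - ξ vecQ * η vecA)
      - u.2.1.2.im * (ξ vecA * η vecP - ξ vecP * η vecA))
    + coeffBR u * (ξ vecQ * η vecP - ξ vecP * η vecQ)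

/-- The derivative of `bivCoord` in the direction `w`. -/
def bivCoordDeriv (u w : CoordBR) (ξ η : CoordBR →L[ℝ] ℝ) : ℝ :=
  (w.2.1.1 * u.2.1.2.re + u.2.1.1 * w.2.1.2.re) * (ξ vecA * η vecQ - ξ vecQ * η vecA)
    - (w.2.1.1 * u.2.1.2.im + u.2.1.1 * w.2.1.2.im) * (ξ vecA * η vecP - ξ vecP * η vecA)
    + 1 / 4 * (w.1 * u.2.1.1 ^ 2 + 2 * u.1 * u.2.1.1 * w.2.1.1 - w.2.2 * (u.2.1.1)⁻¹ ^ 2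
      + 2 * u.2.2 * (u.2.1.1)⁻¹ ^ 3 * w.2.1.1) * (ξ vecQ * η vecP - ξ vecP * η vecQ)

theorem bivectorBR_eq (p : BR) (ξ η : CoordBR →L[ℝ] ℝ) :
    bivectorBR p ξ η = bivCoord (coordBR p) ξ η := by
  rw [bivectorBR_apply]
  simp only [covector_apply _ (-_), covector_apply _ 0 (_ * _), bivCoord, coeffBR, vecA, vecP, vecQ]
  simp
  ring

/-- The Poisson bracket in coordinates. -/
def bracketCoord (F G : CoordBR → ℝ) (u : CoordBR) : ℝ :=
  bivCoord u (fderiv ℝ F u) (fderiv ℝ G u)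

theorem contDiffOn_coeffBR : ContDiffOn ℝ ∞ coeffBR domBR := by
  have h : ∀ u ∈ domBR, u.2.1.1 ≠ 0 := fun u hu => ne_of_gt hu
  unfold coeffBR
  fun_prop (disch := assumption)

theorem contDiffOn_fderiv_apply {F : CoordBR → ℝ} (hF : ContDiffOn ℝ ∞ F domBR)
    (v : CoordBR) : ContDiffOn ℝ ∞ (fun u => fderiv ℝ F u v) domBR :=
  (hF.fderiv_of_isOpen isOpen_domBR (by simp)).clm_apply contDiffOn_const

theorem contDiffOn_re_im : ContDiffOn ℝ ∞ (fun u : CoordBR => u.2.1.2.re) domBR ∧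
    ContDiffOn ℝ ∞ (fun u : CoordBR => u.2.1.2.im) domBR :=
  have h : ContDiff ℝ ∞ (fun u : CoordBR => u.2.1.2) := by fun_prop
  ⟨(Complex.reCLM.contDiff.comp h).contDiffOn, (Complex.imCLM.contDiff.comp h).contDiffOn⟩

theorem contDiffOn_bracketCoord {F G : CoordBR → ℝ} (hF : ContDiffOn ℝ ∞ F domBR)
    (hG : ContDiffOn ℝ ∞ G domBR) : ContDiffOn ℝ ∞ (bracketCoord F G) domBR := by
  have h1 := contDiffOn_fderiv_apply hF
  have h2 := contDiffOn_fderiv_apply hG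
  obtain ⟨h3, h4⟩ := contDiffOn_re_im
  have h5 : ContDiffOn ℝ ∞ (fun u : CoordBR => u.2.1.1) domBR := by fun_prop
  exact (h5.mul ((h3.mul (((h1 _).mul (h2 _)).sub ((h1 _).mul (h2 _)))).sub
    (h4.mul (((h1 _).mul (h2 _)).sub ((h1 _).mul (h2 _)))))).add
    (contDiffOn_coeffBR.mul (((h1 _).mul (h2 _)).sub ((h1 _).mul (h2 _))))

theorem differential_comp_coordBR {k : CoordBR → ℝ} (hk : ContDiffOn ℝ ∞ k domBR) (p : BR) :
    differential modelBR (k ∘ coordBR) p = fderiv ℝ k (coordBR p) :=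
  mfderiv_comp_coordBR ((hk.contDiffAt (domBR_mem_nhds p)).differentiableAt (by simp))

theorem poissonBracket_comp_coordBR {F G : CoordBR → ℝ} (hF : ContDiffOn ℝ ∞ F domBR)
    (hG : ContDiffOn ℝ ∞ G domBR) :
    poissonBracket bivectorBR (F ∘ coordBR) (G ∘ coordBR) = bracketCoord F G ∘ coordBR := by
  funext p
  rw [poissonBracket, differential_comp_coordBR hF, differential_comp_coordBR hG]
  exact bivectorBR_eq p _ _

theorem exists_comp_coordBR (f : C^∞⟮modelBR, BR; ℝ⟯) :
    ∃ F : CoordBR → ℝ, ContDiffOn ℝ ∞ F domBR ∧ ⇑f = F ∘ coordBR :=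
  ⟨f ∘ arrowBR, contDiffOn_comp_arrowBR f.contMDiff, by
    rw [Function.comp_assoc]
    exact funext fun p => (congrArg f (arrowBR_coordBR p)).symm⟩

/-- The second derivative. -/
abbrev secondDeriv (F : CoordBR → ℝ) (u w : CoordBR) : CoordBR →L[ℝ] ℝ :=
  fderiv ℝ (fderiv ℝ F) u w

theorem secondDeriv_symm {F : CoordBR → ℝ} (hF : ContDiffOn ℝ ∞ F domBR) {u : CoordBR}
    (hu : u ∈ domBR) (v w : CoordBR) : secondDeriv F u v w = secondDeriv F u w v :=
  (hF.contDiffAt (isOpen_domBR.mem_nhds hu)).isSymmSndFDerivAt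
    (by simpa using WithTop.coe_le_coe.2 (le_top : (2 : ℕ∞) ≤ ⊤)) v w

theorem hasFDerivAt_fderiv {F : CoordBR → ℝ} (hF : ContDiffOn ℝ ∞ F domBR) {u : CoordBR}
    (hu : u ∈ domBR) : HasFDerivAt (fderiv ℝ F) (fderiv ℝ (fderiv ℝ F) u) u :=
  ((hF.fderiv_of_isOpen (m := ∞) isOpen_domBR (by simp)).contDiffAt
    (isOpen_domBR.mem_nhds hu)).differentiableAt (by simp) |>.hasFDerivAt

/-- The product rule: one term differentiates the coefficients of the bivector, the other two
differentiate `dF` and `dG`. -/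
theorem fderiv_bracketCoord {F G : CoordBR → ℝ} (hF : ContDiffOn ℝ ∞ F domBR)
    (hG : ContDiffOn ℝ ∞ G domBR) {u : CoordBR} (hu : u ∈ domBR) (w : CoordBR) :
    fderiv ℝ (bracketCoord F G) u w = bivCoordDeriv u w (fderiv ℝ F u) (fderiv ℝ G u)
      + bivCoord u (secondDeriv F u w) (fderiv ℝ G u)
      + bivCoord u (fderiv ℝ F u) (secondDeriv G u w) := by
  have h1 := fun v => (hasFDerivAt_fderiv hF hu).clm_apply (hasFDerivAt_const v u)
  have h2 := fun v => (hasFDerivAt_fderiv hG hu).clm_apply (hasFDerivAt_const v u)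
  have hx : HasFDerivAt (fun u : CoordBR => u.1) (ContinuousLinearMap.fst ℝ ℝ _) u :=
    hasFDerivAt_fst
  let aL : CoordBR →L[ℝ] ℝ :=
    (ContinuousLinearMap.fst ℝ ℝ ℂ).comp ((ContinuousLinearMap.fst ℝ _ ℝ).comp
      (ContinuousLinearMap.snd ℝ ℝ _))
  let zL : CoordBR →L[ℝ] ℂ :=
    (ContinuousLinearMap.snd ℝ ℝ ℂ).comp ((ContinuousLinearMap.fst ℝ _ ℝ).comp
      (ContinuousLinearMap.snd ℝ ℝ _))
  let yL : CoordBR →L[ℝ] ℝ :=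
    (ContinuousLinearMap.snd ℝ _ ℝ).comp (ContinuousLinearMap.snd ℝ ℝ _)
  have ha : HasFDerivAt (fun u : CoordBR => u.2.1.1) aL u := aL.hasFDerivAt
  have hp : HasFDerivAt (fun u : CoordBR => u.2.1.2.re) (Complex.reCLM.comp zL) u :=
    (Complex.reCLM.comp zL).hasFDerivAt
  have hq : HasFDerivAt (fun u : CoordBR => u.2.1.2.im) (Complex.imCLM.comp zL) u :=
    (Complex.imCLM.comp zL).hasFDerivAt
  have hy : HasFDerivAt (fun u : CoordBR => u.2.2) yL u := yL.hasFDerivAt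
  have ha0 : u.2.1.1 ≠ 0 := ne_of_gt hu
  have hai := (hasDerivAt_inv ha0).comp_hasFDerivAt u ha
  have hc := ((hx.mul (ha.pow 2)).sub (hy.mul (hai.pow 2))).const_mul (1 / 4)
  have h := (ha.mul ((hp.mul (((h1 vecA).mul (h2 vecQ)).sub ((h1 vecQ).mul (h2 vecA)))).sub
    (hq.mul (((h1 vecA).mul (h2 vecP)).sub ((h1 vecP).mul (h2 vecA)))))).add
    (hc.mul (((h1 vecQ).mul (h2 vecP)).sub ((h1 vecP).mul (h2 vecQ))))
  refine (congrArg (fun L : CoordBR →L[ℝ] ℝ => L w) h.fderiv).trans ?_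
  simp [bivCoordDeriv, bivCoord, coeffBR, aL, yL, zL]
  field_simp
  ring

theorem bracketCoord_jacobi {F G K : CoordBR → ℝ} (hF : ContDiffOn ℝ ∞ F domBR)
    (hG : ContDiffOn ℝ ∞ G domBR) (hK : ContDiffOn ℝ ∞ K domBR) {u : CoordBR} (hu : u ∈ domBR) :
    bracketCoord F (bracketCoord G K) u + bracketCoord G (bracketCoord K F) u
      + bracketCoord K (bracketCoord F G) u = 0 := by
  have hu0 : u.2.1.1 ≠ 0 := ne_of_gt hu
  rw [bracketCoord, bracketCoord, bracketCoord]
  simp only [bivCoord, fderiv_bracketCoord hF hG hu, fderiv_bracketCoord hG hK hu,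
    fderiv_bracketCoord hK hF hu, bivCoordDeriv]
  -- Mixed second derivatives are put in one fixed order. They then cancel by antisymmetry of the
  -- bivector, and only the derivatives of its coefficients remain.
  rw [secondDeriv_symm hF hu vecP vecA, secondDeriv_symm hF hu vecQ vecA,
    secondDeriv_symm hF hu vecQ vecP, secondDeriv_symm hG hu vecP vecA,
    secondDeriv_symm hG hu vecQ vecA, secondDeriv_symm hG hu vecQ vecP,
    secondDeriv_symm hK hu vecP vecA, secondDeriv_symm hK hu vecQ vecA,
    secondDeriv_symm hK hu vecQ vecP]
  have e1 : vecA.1 = 0 ∧ vecA.2.1.1 = 1 ∧ vecA.2.1.2.re = 0 ∧ vecA.2.1.2.im = 0 ∧ vecA.2.2 = 0 :=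
    ⟨rfl, rfl, rfl, rfl, rfl⟩
  have e2 : vecP.1 = 0 ∧ vecP.2.1.1 = 0 ∧ vecP.2.1.2.re = 1 ∧ vecP.2.1.2.im = 0 ∧ vecP.2.2 = 0 :=
    ⟨rfl, rfl, rfl, rfl, rfl⟩
  have e3 : vecQ.1 = 0 ∧ vecQ.2.1.1 = 0 ∧ vecQ.2.1.2.re = 0 ∧ vecQ.2.1.2.im = 1 ∧ vecQ.2.2 = 0 :=
    ⟨rfl, rfl, rfl, rfl, rfl⟩
  simp only [e1, e2, e3]
  ring

theorem isPoisson_BR : IsPoisson bivectorBR where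
  bivector p ξ := by
    refine (bivectorBR_eq p ξ ξ).trans ?_
    unfold bivCoord
    ring
  smooth f g := by
    obtain ⟨F, hF, hf⟩ := exists_comp_coordBR f
    obtain ⟨G, hG, hg⟩ := exists_comp_coordBR g
    rw [hf, hg, poissonBracket_comp_coordBR hF hG]
    exact contMDiff_comp_coordBR (contDiffOn_bracketCoord hF hG)
  jacobi f g h p := by
    obtain ⟨F, hF, hf⟩ := exists_comp_coordBR f
    obtain ⟨G, hG, hg⟩ := exists_comp_coordBR g
    obtain ⟨K, hK, hh⟩ := exists_comp_coordBR h
    rw [hf, hg, hh, poissonBracket_comp_coordBR hF hG, poissonBracket_comp_coordBR hG hK,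
      poissonBracket_comp_coordBR hK hF,
      poissonBracket_comp_coordBR hF (contDiffOn_bracketCoord hG hK),
      poissonBracket_comp_coordBR hG (contDiffOn_bracketCoord hK hF),
      poissonBracket_comp_coordBR hK (contDiffOn_bracketCoord hF hG)]
    exact bracketCoord_jacobi hF hG hK (coordBR_mem p)

theorem isPoissonGroupoid_BR : IsPoissonGroupoid modelBR 𝓘(ℝ, ℝ) groupoidBR bivectorBR where
  isLieGroupoid := isLieGroupoid_BR
  isPoisson := isPoisson_BR
  coisotropic := isCoisotropic_graph_BR

/-! ### The Lie bialgebroid -/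

theorem contDiff_section (X : SecBR) : ContDiff ℝ ∞ X := X.contMDiff.contDiff

theorem hasDerivAt_section (X : SecBR) (y : ℝ) : HasDerivAt X (deriv X y) y :=
  ((contDiff_section X).differentiable (by simp) y).hasDerivAt

theorem hasDerivAt_deriv_section (X : SecBR) (y : ℝ) :
    HasDerivAt (deriv X) (deriv (deriv X) y) y :=
  ((contDiff_infty_iff_deriv.1 (contDiff_section X)).2.differentiable (by simp) y).hasDerivAt

theorem HasDerivAt.bBracket {v w : ℝ → Fib} {v' w' : Fib} {y : ℝ} (hv : HasDerivAt v v' y)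
    (hw : HasDerivAt w w' y) :
    HasDerivAt (fun s => ((ContractionGroupoid.bBracket (v s).1 (w s).1, 0) : Fib))
      (ContractionGroupoid.bBracket v'.1 (w y).1 + ContractionGroupoid.bBracket (v y).1 w'.1, 0) y := by
  have h1 : HasDerivAt (fun s => (v s).1.1) v'.1.1 y := by
    simpa using HasFDerivAt.hasDerivAt hv.fst.fst
  have h2 : HasDerivAt (fun s => (v s).1.2) v'.1.2 y := by
    simpa using HasFDerivAt.hasDerivAt hv.fst.snd
  have h3 : HasDerivAt (fun s => (w s).1.1) w'.1.1 y := by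
    simpa using HasFDerivAt.hasDerivAt hw.fst.fst
  have h4 : HasDerivAt (fun s => (w s).1.2) w'.1.2 y := by
    simpa using HasFDerivAt.hasDerivAt hw.fst.snd
  simp only [bBracket_eq]
  have h := ((hasDerivAt_const y (0 : ℝ)).prodMk (((h3.const_mul 2).smul h2).sub
    ((h1.const_mul 2).smul h4))).prodMk (hasDerivAt_const y (0 : ℝ))
  refine h.congr_deriv ?_
  ext <;> simp
  all_goals ring

theorem deriv_bracketBR (X Y : SecBR) (y : ℝ) : deriv (bracketBR X Y) y =
    ((bBracket (deriv X y).1 (Y y).1 + bBracket (X y).1 (deriv Y y).1, 0) : Fib)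
      + (deriv X y).2 • deriv Y y + (X y).2 • deriv (deriv Y) y
      - (deriv Y y).2 • deriv X y - (Y y).2 • deriv (deriv X) y := by
  have hX := hasDerivAt_section X y
  have hY := hasDerivAt_section Y y
  have hX2 : HasDerivAt (fun s => (X s).2) (deriv X y).2 y := by
    simpa using HasFDerivAt.hasDerivAt hX.snd
  have hY2 : HasDerivAt (fun s => (Y s).2) (deriv Y y).2 y := by
    simpa using HasFDerivAt.hasDerivAt hY.snd
  have h := ((HasDerivAt.bBracket hX hY).add (hX2.smul (hasDerivAt_deriv_section Y y))).sub
    (hY2.smul (hasDerivAt_deriv_section X y))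
  refine (HasDerivAt.deriv h).trans ?_
  module

theorem isLieAlgebroid_BR : algebroidBR.IsLieAlgebroid where
  anchor_smooth X := by
    intro y
    rw [contMDiffAt_vectorSpace_iff_contDiffAt]
    exact (contDiff_snd.comp (contDiff_section X)).contDiffAt
  bracket_self X := by
    ext y : 1
    change bracketBR X X y = 0
    rw [bracketBR_apply, bBracket_eq]
    ext <;> simp
  jacobi X Y Z := by
    ext y : 1
    change bracketBR X (bracketBR Y Z) y + bracketBR Y (bracketBR Z X) y
      + bracketBR Z (bracketBR X Y) y = 0
    rw [bracketBR_apply X, bracketBR_apply Y, bracketBR_apply Z]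
    simp only [deriv_bracketBR, bracketBR_apply, bBracket_eq]
    ext <;> simp <;> ring
  leibniz X Y f y := by
    have hf : HasDerivAt f (deriv f y) y :=
      (f.contMDiff.contDiff.differentiable (by simp) y).hasDerivAt
    have hd : deriv (f • Y) y = f y • deriv Y y + deriv f y • Y y :=
      (hf.smul (hasDerivAt_section Y y)).deriv
    have he : differential 𝓘(ℝ, ℝ) f y (algebroidBR.anchor y (X y)) = (X y).2 * deriv f y := by
      rw [differential, mfderiv_eq_fderiv]
      exact fderiv_eq_smul_deriv (f := f) (X y).2
    rw [he]
    change bracketBR X (f • Y) y = f y • bracketBR X Y y + ((X y).2 * deriv f y) • Y y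
    have hY : (f • Y) y = f y • Y y := rfl
    simp only [bracketBR_apply, hY, hd, bBracket_eq]
    ext <;> simp <;> ring

/-- The bracket is fibrewise bilinear. As `J₀` is central, the Jacobi identity need only be tested
on `J₁, J₂, J₃`. The bracket of two of these is a multiple of the third up to `J₀`, so each double
bracket in the cyclic sum vanishes. -/
theorem isLieAlgebroid_dualBR : dualAlgebroidBR.IsLieAlgebroid where
  anchor_smooth X := by
    intro y
    rw [contMDiffAt_vectorSpace_iff_contDiffAt]
    exact contDiffAt_const
  bracket_self ξ := by
    ext y : 1
    change extBracket y (ξ y) (ξ y) = 0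
    simp only [extBracket]
    module
  jacobi ξ η ζ := by
    ext y : 1
    change extBracket y (ξ y) (extBracket y (η y) (ζ y)) + extBracket y (η y)
      (extBracket y (ζ y) (ξ y)) + extBracket y (ζ y) (extBracket y (ξ y) (η y)) = 0
    have h1 : ∀ α β : Fib →L[ℝ] ℝ, extBracket y α β (hatJ 1)
        = 2 * y * (α (hatJ 2) * β (hatJ 3) - α (hatJ 3) * β (hatJ 2)) := fun α β => by
      simp [extBracket, dualJ_hatJ]; ring
    have h2 : ∀ α β : Fib →L[ℝ] ℝ, extBracket y α β (hatJ 2)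
        = 2 * (α (hatJ 3) * β (hatJ 1) - α (hatJ 1) * β (hatJ 3)) := fun α β => by
      simp [extBracket, dualJ_hatJ]; ring
    have h3 : ∀ α β : Fib →L[ℝ] ℝ, extBracket y α β (hatJ 3)
        = 2 * (α (hatJ 1) * β (hatJ 2) - α (hatJ 2) * β (hatJ 1)) := fun α β => by
      simp [extBracket, dualJ_hatJ]; ring
    -- Only the outer brackets are unfolded. They see the inner ones through the components `h1`,
    -- `h2`, `h3`; the central component does not enter.
    rw [extBracket.eq_1 y (ξ y) (extBracket y (η y) (ζ y)),
      extBracket.eq_1 y (η y) (extBracket y (ζ y) (ξ y)),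
      extBracket.eq_1 y (ζ y) (extBracket y (ξ y) (η y))]
    simp only [h1, h2, h3]
    module
  leibniz ξ η f y := by
    have he : differential 𝓘(ℝ, ℝ) f y (dualAlgebroidBR.anchor y (ξ y)) = 0 := map_zero _
    rw [he, zero_smul, add_zero]
    change extBracket y (ξ y) (f y • η y) = f y • extBracket y (ξ y) (η y)
    simp only [extBracket, smul_apply, smul_eq_mul]
    module

/-! ### The cobracket and its compatibility with the bracket -/

theorem cobracketBR_apply (X : SecBR) (y : ℝ) (ξ η : Fib →L[ℝ] ℝ) :
    cobracketBR X y ξ η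
      = 4 * (ξ (hatJ 1) * η (hatJ 2) - ξ (hatJ 2) * η (hatJ 1)) * (X y).1.2.re
      + (ξ (hatJ 2) * η (hatJ 3) - ξ (hatJ 3) * η (hatJ 2)) * ((X y).2 - 4 * y * (X y).1.1)
      + 4 * (ξ (hatJ 3) * η (hatJ 1) - ξ (hatJ 1) * η (hatJ 3)) * (X y).1.2.im := by
  have h : cobracketBR X y ξ η = extBracket y ξ η (X y) - η (sectionDeriv X y 0)
    + ξ (sectionDeriv X y 0) := rfl
  rw [h]
  simp [extBracket, dualJ]
  ring

theorem cobracketBR_linear (X X' : SecBR) (f : C^∞⟮𝓘(ℝ, ℝ), ℝ; ℝ⟯) (y : ℝ) :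
    cobracketBR (X + f • X') y = cobracketBR X y + f y • cobracketBR X' y := by
  ext ξ η
  have h : (X + f • X') y = X y + f y • X' y := rfl
  simp only [cobracketBR_apply, LinearMap.add_apply, LinearMap.smul_apply, h]
  simp
  ring

theorem cobracketBR_secJ (y : ℝ) :
    cobracketBR (secJ 0) y = (2 : ℝ) • wedge (hatJ 2) (hatJ 3) ∧
    cobracketBR (secJ 1) y = (2 * y) • wedge (hatJ 2) (hatJ 3) ∧
    cobracketBR (secJ 2) y = (2 : ℝ) • wedge (hatJ 3) (hatJ 1) ∧
    cobracketBR (secJ 3) y = (2 : ℝ) • wedge (hatJ 1) (hatJ 2) := by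
  have hw : ∀ v w : Fib, ∀ ξ η, wedge v w ξ η = ξ v * η w - ξ w * η v := fun _ _ _ _ => rfl
  have e0 : secJ 0 y = (0, 2) := rfl
  have e1 : secJ 1 y = ((-1 / 2, 0), 0) := rfl
  have e2 : secJ 2 y = ((0, Complex.I / 2), 0) := rfl
  have e3 : secJ 3 y = ((0, 1 / 2), 0) := rfl
  refine ⟨?_, ?_, ?_, ?_⟩ <;> ext ξ η <;>
    simp only [cobracketBR_apply, LinearMap.smul_apply, hw, e0, e1, e2, e3, smul_eq_mul] <;>
    simp <;> ring

theorem covector_Fib_apply (ξ : Fib →L[ℝ] ℝ) (v : Fib) :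
    ξ v = v.2 / 2 * ξ (hatJ 0) - 2 * v.1.1 * ξ (hatJ 1) + 2 * v.1.2.im * ξ (hatJ 2)
      + 2 * v.1.2.re * ξ (hatJ 3) := by
  have h : v = (v.2 / 2) • hatJ 0 - (2 * v.1.1) • hatJ 1 + (2 * v.1.2.im) • hatJ 2
      + (2 * v.1.2.re) • hatJ 3 := by
    refine Prod.ext (Prod.ext ?_ (Complex.ext ?_ ?_)) ?_ <;> simp [hatJ] <;> ring
  conv_lhs => rw [h]
  simp only [map_add, map_sub, map_smul, smul_eq_mul]

theorem deriv_clm_comp_section (X : SecBR) (y : ℝ) :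
    HasDerivAt (fun s => (X s).1.1) (deriv X y).1.1 y ∧
      HasDerivAt (fun s => (X s).1.2.re) (deriv X y).1.2.re y ∧
      HasDerivAt (fun s => (X s).1.2.im) (deriv X y).1.2.im y ∧
      HasDerivAt (fun s => (X s).2) (deriv X y).2 y := by
  have h := hasDerivAt_section X y
  have h1 : HasDerivAt (fun s => (X s).1.2) (deriv X y).1.2 y := by
    simpa using HasFDerivAt.hasDerivAt h.fst.snd
  refine ⟨by simpa using HasFDerivAt.hasDerivAt h.fst.fst,
    Complex.reCLM.hasFDerivAt.comp_hasDerivAt y h1, Complex.imCLM.hasFDerivAt.comp_hasDerivAt y h1,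
    by simpa using HasFDerivAt.hasDerivAt h.snd⟩

theorem hasDerivAt_cobracketBR (X : SecBR) (y : ℝ) (ξ η : Fib →L[ℝ] ℝ) :
    HasDerivAt (fun s => cobracketBR X s ξ η)
      (4 * (ξ (hatJ 1) * η (hatJ 2) - ξ (hatJ 2) * η (hatJ 1)) * (deriv X y).1.2.re
      + (ξ (hatJ 2) * η (hatJ 3) - ξ (hatJ 3) * η (hatJ 2)) *
        ((deriv X y).2 - 4 * (X y).1.1 - 4 * y * (deriv X y).1.1)
      + 4 * (ξ (hatJ 3) * η (hatJ 1) - ξ (hatJ 1) * η (hatJ 3)) * (deriv X y).1.2.im) y := by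
  obtain ⟨h1, h2, h3, h4⟩ := deriv_clm_comp_section X y
  simp only [cobracketBR_apply]
  have h := ((h2.const_mul (4 * (ξ (hatJ 1) * η (hatJ 2) - ξ (hatJ 2) * η (hatJ 1)))).add
    ((h4.sub (((hasDerivAt_id y).const_mul 4).mul h1)).const_mul
      (ξ (hatJ 2) * η (hatJ 3) - ξ (hatJ 3) * η (hatJ 2)))).add
    (h3.const_mul (4 * (ξ (hatJ 3) * η (hatJ 1) - ξ (hatJ 1) * η (hatJ 3))))
  refine h.congr_deriv ?_
  simp only [id]
  ring

theorem adConst_algebroidBR (X : SecBR) (y : ℝ) (v : Fib) :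
    adConst algebroidBR X y v = ((bBracket (X y).1 v.1, 0) : Fib) - v.2 • deriv X y := by
  have h : adConst algebroidBR X y v = bracketBR X (constSection 𝓘(ℝ, ℝ) ℝ Fib v) y := rfl
  have h1 : deriv (constSection 𝓘(ℝ, ℝ) ℝ Fib v) y = 0 := deriv_const y v
  have h2 : constSection 𝓘(ℝ, ℝ) ℝ Fib v y = v := rfl
  rw [h, bracketBR_apply, h1, h2, smul_zero, add_zero]

theorem gerstenhaber_algebroidBR (X Y : SecBR) (y : ℝ) (ξ η : Fib →L[ℝ] ℝ) :
    gerstenhaber algebroidBR X (cobracketBR Y) y ξ η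
      = (X y).2 * deriv (fun s => cobracketBR Y s ξ η) y
        + cobracketBR Y y (ξ.comp (adConst algebroidBR X y)) η
        + cobracketBR Y y ξ (η.comp (adConst algebroidBR X y)) := by
  have he : differential 𝓘(ℝ, ℝ) (fun s => cobracketBR Y s ξ η) y
      (algebroidBR.anchor y (X y)) = (X y).2 * deriv (fun s => cobracketBR Y s ξ η) y := by
    rw [differential, mfderiv_eq_fderiv]
    exact fderiv_eq_smul_deriv (f := fun s => cobracketBR Y s ξ η) (X y).2
  rw [gerstenhaber, he]

/-- The cobracket involves covectors only through their values on `Ĵ₁, Ĵ₂, Ĵ₃`, so these suffice for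
the Gerstenhaber bracket. No derivative of `X` appears, because these vectors have no `∂/∂y`
component. -/
theorem covector_comp_adConst (X : SecBR) (y : ℝ) (ξ : Fib →L[ℝ] ℝ) :
    ξ.comp (adConst algebroidBR X y) (hatJ 1)
        = -2 * (X y).1.2.im * ξ (hatJ 2) - 2 * (X y).1.2.re * ξ (hatJ 3) ∧
      ξ.comp (adConst algebroidBR X y) (hatJ 2) = -2 * (X y).1.1 * ξ (hatJ 2) ∧
      ξ.comp (adConst algebroidBR X y) (hatJ 3) = -2 * (X y).1.1 * ξ (hatJ 3) := by
  have e1 : (hatJ 1).1.1 = -1 / 2 ∧ (hatJ 1).1.2 = 0 ∧ (hatJ 1).2 = 0 := ⟨rfl, rfl, rfl⟩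
  have e2 : (hatJ 2).1.1 = 0 ∧ (hatJ 2).1.2 = Complex.I / 2 ∧ (hatJ 2).2 = 0 := ⟨rfl, rfl, rfl⟩
  have e3 : (hatJ 3).1.1 = 0 ∧ (hatJ 3).1.2 = 1 / 2 ∧ (hatJ 3).2 = 0 := ⟨rfl, rfl, rfl⟩
  simp only [ContinuousLinearMap.comp_apply, adConst_algebroidBR]
  refine ⟨?_, ?_, ?_⟩
  · rw [covector_Fib_apply, bBracket_eq]
    simp [e1]
    ring
  · rw [covector_Fib_apply, bBracket_eq]
    simp [e2]
    exact Or.inl (by ring)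
  · rw [covector_Fib_apply, bBracket_eq]
    simp [e3]
    exact Or.inl (by ring)

/-- The critical pair is `Ĵ₀, Ĵ₁`, with `[Ĵ₀, Ĵ₁] = 0`: differentiating the coefficient `2 y` of `δ
Ĵ₁` along `Ĵ₀ = 2 ∂/∂y` gives `4 Ĵ₂ ∧ Ĵ₃`, and `[Ĵ₁, δ Ĵ₀]` gives the same, since `Ĵ₁` acts as the
identity on `Ĵ₂` and `Ĵ₃`. -/
theorem isLieBialgebroid_BR : IsLieBialgebroid algebroidBR dualAlgebroidBR where
  isLieAlgebroid := isLieAlgebroid_BR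
  isLieAlgebroid_dual := isLieAlgebroid_dualBR
  cocycle X Y y ξ η := by
    have h : algebroidBR.bracket X Y y = bracketBR X Y y := rfl
    have hX := covector_comp_adConst X y
    have hY := covector_comp_adConst Y y
    rw [gerstenhaber_algebroidBR, gerstenhaber_algebroidBR, (hasDerivAt_cobracketBR X y ξ η).deriv,
      (hasDerivAt_cobracketBR Y y ξ η).deriv]
    simp only [cobracketBR_apply, (hX _).1, (hX _).2.1, (hX _).2.2, (hY _).1, (hY _).2.1,
      (hY _).2.2, h, bracketBR_apply, bBracket_eq]
    simp
    ring

/-! ### The Lie bialgebroid of the Poisson groupoid -/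

/-- Left translation in coordinates. -/
def leftCoord (u : CoordBR) (v : Fib) : CoordBR :=
  (0, (u.2.1.1 * v.1.1, v.1.1 • u.2.1.2 + u.2.1.1⁻¹ • v.1.2), v.2)

/-- The derivative of `leftCoord` in the direction `w`. -/
def leftCoordDeriv (u w : CoordBR) (v : Fib) : CoordBR :=
  (0, (w.2.1.1 * v.1.1, v.1.1 • w.2.1.2 - (w.2.1.1 / u.2.1.1 ^ 2) • v.1.2), 0)

theorem leftFrame_eq (p : BR) (v : Fib) : leftFrame p v = leftCoord (coordBR p) v := by
  have h : leftFrame p v = tangentBR p 0 (matrixOf p.2.1 * bMatrix v.1) v.2 := rfl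
  rw [h, (matrixOf_eq p.2.1).2, tangentBR, leftCoord]
  refine Prod.ext rfl (Prod.ext (Prod.ext ?_ ?_) rfl) <;>
    simp [coord, lowerMatrix, bMatrix, coordBR, Matrix.mul_apply, Fin.sum_univ_two, mul_comm]

/-- The left invariant vector field of a section, in coordinates. -/
def fieldCoord (X : SecBR) (u : CoordBR) : CoordBR := leftCoord u (X u.2.2)

theorem translate_leftFrame (X : SecBR) (p : BR) :
    translate groupoidBR leftFrame X p = fieldCoord X (coordBR p) := leftFrame_eq p _

theorem contDiffOn_fieldCoord (X : SecBR) : ContDiffOn ℝ ∞ (fieldCoord X) domBR := by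
  have h : ∀ u ∈ domBR, u.2.1.1 ≠ 0 := fun u hu => ne_of_gt hu
  have hX := contDiff_section X
  unfold fieldCoord leftCoord
  fun_prop (disch := assumption)

theorem fderiv_fieldCoord (X : SecBR) {u : CoordBR} (hu : u ∈ domBR) (w : CoordBR) :
    fderiv ℝ (fieldCoord X) u w
      = leftCoordDeriv u w (X u.2.2) + w.2.2 • leftCoord u (deriv X u.2.2) := by
  have ha0 : u.2.1.1 ≠ 0 := ne_of_gt hu
  -- The Fréchet derivative at `w` is found by differentiating along a line in two ways, which needs
  -- only one-variable rules.
  let line : ℝ → CoordBR := fun τ => u + τ • w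
  have hl : HasDerivAt line w 0 := hasDerivAt_line u w 0
  have h0 : line 0 = u := by simp [line]
  have h1 : HasDerivAt (fieldCoord X ∘ line) (fderiv ℝ (fieldCoord X) u w) 0 := by
    have := ((contDiffOn_fieldCoord X).contDiffAt (isOpen_domBR.mem_nhds hu)).differentiableAt
      (by simp) |>.hasFDerivAt
    rw [← h0] at this
    simpa [h0] using this.comp_hasDerivAt (0 : ℝ) hl
  have ha : HasDerivAt (fun s => (line s).2.1.1) w.2.1.1 0 := by
    simpa using HasFDerivAt.hasDerivAt hl.snd.fst.fst
  have hz : HasDerivAt (fun s => (line s).2.1.2) w.2.1.2 0 := by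
    simpa using HasFDerivAt.hasDerivAt hl.snd.fst.snd
  have hy : HasDerivAt (fun s => (line s).2.2) w.2.2 0 := by
    simpa using HasFDerivAt.hasDerivAt hl.snd.snd
  have hX : HasDerivAt (fun s => X (line s).2.2) (w.2.2 • deriv X u.2.2) 0 := by
    have h := hasDerivAt_section X u.2.2
    rw [← h0] at h
    have h' := h.scomp (0 : ℝ) hy
    simp only [h0] at h'
    exact h'
  have hv : HasDerivAt (fun s => (X (line s).2.2).1.1) (w.2.2 • deriv X u.2.2).1.1 0 := by
    simpa using HasFDerivAt.hasDerivAt hX.fst.fst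
  have hw : HasDerivAt (fun s => (X (line s).2.2).1.2) (w.2.2 • deriv X u.2.2).1.2 0 := by
    simpa using HasFDerivAt.hasDerivAt hX.fst.snd
  have ht : HasDerivAt (fun s => (X (line s).2.2).2) (w.2.2 • deriv X u.2.2).2 0 := by
    simpa using HasFDerivAt.hasDerivAt hX.snd
  have h2 := (hasDerivAt_const (0 : ℝ) (0 : ℝ)).prodMk (((ha.mul hv).prodMk ((hv.smul hz).add
    ((ha.inv (by rwa [h0])).smul hw))).prodMk ht)
  refine (h1.unique h2).trans ?_
  simp only [h0, Pi.inv_apply]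
  refine Prod.ext ?_ (Prod.ext (Prod.ext ?_ (Complex.ext ?_ ?_)) ?_) <;>
    simp [leftCoordDeriv, leftCoord, -Complex.real_smul, Complex.smul_re, Complex.smul_im] <;>
    ring

theorem isLeftInvariant_translate_leftFrame (X : SecBR) :
    IsLeftInvariant modelBR 𝓘(ℝ, ℝ) groupoidBR (translate groupoidBR leftFrame X) where
  smooth := contMDiff_vectorField_BR (contDiffOn_fieldCoord X) (translate_leftFrame X)
  tangent p := by
    have h : mfderiv modelBR 𝓘(ℝ, ℝ) groupoidBR.src p
        = ContinuousLinearMap.fst ℝ (TangentSpace 𝓘(ℝ, ℝ) p.1)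
          (TangentSpace (𝓘(ℝ, ℝ × ℂ).prod 𝓘(ℝ, ℝ)) p.2) := mfderiv_fst
    rw [h]
    exact congrArg Prod.fst (translate_leftFrame X p)
  invariant f c hc _ hv := by
    replace hv := (hasVelocity_BR_iff c _).1 hv
    have hd : HasDerivAt (coordBR ∘ c) (fieldCoord X (coordBR (c 0))) 0 := by
      have := (hv.1.differentiableAt (by simp)).hasDerivAt
      rwa [hv.2, translate_leftFrame] at this
    have h := hasVelocity_mul (c := fun _ => f) contDiffAt_const
      (hasDerivAt_const (0 : ℝ) (coordBR f)) hv.1 hd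
    -- This is associativity, `f (g v) = (f g) v`, together with the fact that left translation
    -- preserves the target at which `X` is evaluated.
    have he : translate groupoidBR leftFrame X (groupoidBR.mul f (c 0))
        = mulCoordDeriv (coordBR f) (coordBR (c 0)) 0 (fieldCoord X (coordBR (c 0))) := by
      rw [translate_leftFrame, coordBR_mul]
      generalize coordBR f = u
      generalize coordBR (c 0) = v
      refine Prod.ext ?_ (Prod.ext (Prod.ext ?_ (Complex.ext ?_ ?_)) ?_) <;>
        simp [mulCoordDeriv, fieldCoord, leftCoord, mulCoord, -Complex.real_smul, Complex.smul_re,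
          Complex.smul_im]
      all_goals ring
    rw [he]
    exact h

theorem lieBracket_fieldCoord (X Y : SecBR) {u : CoordBR} (hu : u ∈ domBR) :
    VectorField.lieBracket ℝ (fieldCoord X) (fieldCoord Y) u = fieldCoord (bracketBR X Y) u := by
  have ha0 : u.2.1.1 ≠ 0 := ne_of_gt hu
  rw [VectorField.lieBracket, fderiv_fieldCoord X hu, fderiv_fieldCoord Y hu]
  simp only [fieldCoord, bracketBR_apply, bBracket_eq]
  refine Prod.ext ?_ (Prod.ext (Prod.ext ?_ (Complex.ext ?_ ?_)) ?_) <;>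
    simp [leftCoordDeriv, leftCoord, -Complex.real_smul, Complex.smul_re, Complex.smul_im] <;>
    field_simp <;> ring

theorem mfderiv_src_BR (p : BR) (v : CoordBR) :
    mfderiv modelBR 𝓘(ℝ, ℝ) groupoidBR.src p v = v.1 := by
  let L : CoordBR →L[ℝ] ℝ := ContinuousLinearMap.fst ℝ ℝ _
  have h : mfderiv modelBR 𝓘(ℝ, ℝ) (L ∘ coordBR) p = fderiv ℝ L (coordBR p) :=
    mfderiv_comp_coordBR L.differentiableAt
  rw [L.fderiv] at h
  exact congrArg (fun K : CoordBR →L[ℝ] ℝ => K v) h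

theorem mfderiv_tgt_BR (p : BR) (v : CoordBR) :
    mfderiv modelBR 𝓘(ℝ, ℝ) groupoidBR.tgt p v = v.2.2 := by
  let L : CoordBR →L[ℝ] ℝ :=
    (ContinuousLinearMap.snd ℝ _ ℝ).comp (ContinuousLinearMap.snd ℝ ℝ _)
  have h : mfderiv modelBR 𝓘(ℝ, ℝ) (L ∘ coordBR) p = fderiv ℝ L (coordBR p) :=
    mfderiv_comp_coordBR L.differentiableAt
  rw [L.fderiv] at h
  exact congrArg (fun K : CoordBR →L[ℝ] ℝ => K v) h

theorem leftCoord_injective {u : CoordBR} (hu : u ∈ domBR) : Function.Injective (leftCoord u) := by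
  have hu0 : u.2.1.1 ≠ 0 := ne_of_gt hu
  rintro ⟨⟨a, z⟩, t⟩ ⟨⟨b, w⟩, s⟩ h
  simp only [leftCoord, Prod.mk.injEq, true_and] at h
  obtain ⟨⟨h1, h2⟩, rfl⟩ := h
  obtain rfl := mul_left_cancel₀ hu0 h1
  have h3 := smul_right_injective ℂ (inv_ne_zero hu0) (add_left_cancel h2)
  exact congrArg (fun c => ((a, c), t)) h3

theorem exists_leftCoord_eq {u : CoordBR} (hu : u ∈ domBR) (v : CoordBR) :
    (∃ m, leftCoord u m = v) ↔ v.1 = 0 := by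
  have hu0 : u.2.1.1 ≠ 0 := ne_of_gt hu
  constructor
  · rintro ⟨m, rfl⟩
    rfl
  · intro h
    -- The equations are triangular: the diagonal entry comes first, and then the off-diagonal one.
    refine ⟨((u.2.1.1⁻¹ * v.2.1.1, u.2.1.1 • (v.2.1.2 - (u.2.1.1⁻¹ * v.2.1.1) • u.2.1.2)), v.2.2), ?_⟩
    rw [leftCoord]
    refine Prod.ext h.symm (Prod.ext (Prod.ext ?_ ?_) rfl)
    · exact mul_inv_cancel_left₀ hu0 _
    · simp only [inv_smul_smul₀ hu0]
      abel

theorem isLieAlgebroidOf_leftFrame :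
    IsLieAlgebroidOf groupoidBR algebroidBR leftFrame where
  injective p v w h :=
    leftCoord_injective (coordBR_mem p) (((leftFrame_eq p v).symm.trans h).trans (leftFrame_eq p w))
  range_eq p v :=
    (exists_congr fun m => Eq.congr_left (leftFrame_eq p m)).trans
      ((exists_leftCoord_eq (coordBR_mem p) v).trans (Eq.congr_left (mfderiv_src_BR p v)).symm)
  leftInvariant := isLeftInvariant_translate_leftFrame
  anchor_eq p v := by
    rw [leftFrame_eq, mfderiv_tgt_BR]
    rfl
  bracket_eq X Y p :=
    (mlieBracket_BR (translate_leftFrame X) (translate_leftFrame Y) p).trans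
      ((lieBracket_fieldCoord X Y (coordBR_mem p)).trans
        (translate_leftFrame (bracketBR X Y) p).symm)

/-! ### The Lie derivative of the bivector along left invariant fields -/

theorem differential_along_fieldCoord {F : CoordBR → ℝ} (hF : ContDiffOn ℝ ∞ F domBR) (X : SecBR) :
    (fun q => differential modelBR (F ∘ coordBR) q (translate groupoidBR leftFrame X q))
      = (fun u => fderiv ℝ F u (fieldCoord X u)) ∘ coordBR := by
  funext p
  rw [differential_comp_coordBR hF, translate_leftFrame]
  rfl

theorem contDiffOn_along_fieldCoord {F : CoordBR → ℝ} (hF : ContDiffOn ℝ ∞ F domBR) (X : SecBR) :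
    ContDiffOn ℝ ∞ (fun u => fderiv ℝ F u (fieldCoord X u)) domBR :=
  (hF.fderiv_of_isOpen isOpen_domBR (by simp)).clm_apply (contDiffOn_fieldCoord X)

theorem fderiv_along_fieldCoord {F : CoordBR → ℝ} (hF : ContDiffOn ℝ ∞ F domBR) (X : SecBR)
    {u : CoordBR} (hu : u ∈ domBR) (w : CoordBR) :
    fderiv ℝ (fun u => fderiv ℝ F u (fieldCoord X u)) u w
      = secondDeriv F u (fieldCoord X u) w
        + fderiv ℝ F u (leftCoordDeriv u w (X u.2.2) + w.2.2 • leftCoord u (deriv X u.2.2)) := by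
  have h := (hasFDerivAt_fderiv hF hu).clm_apply (((contDiffOn_fieldCoord X).contDiffAt
    (isOpen_domBR.mem_nhds hu)).differentiableAt (by simp)).hasFDerivAt
  rw [h.fderiv, secondDeriv_symm hF hu, ← fderiv_fieldCoord X hu]
  simp [add_comm]

theorem covector_leftCoord (u : CoordBR) (ξ : CoordBR →L[ℝ] ℝ) :
    ξ (leftCoord u (hatJ 1)) = -(1 / 2) * (u.2.1.1 * ξ vecA + u.2.1.2.re * ξ vecP
        + u.2.1.2.im * ξ vecQ) ∧
      ξ (leftCoord u (hatJ 2)) = u.2.1.1⁻¹ / 2 * ξ vecQ ∧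
      ξ (leftCoord u (hatJ 3)) = u.2.1.1⁻¹ / 2 * ξ vecP := by
  refine ⟨?_, ?_, ?_⟩ <;> simp only [leftCoord, hatJ] <;> simp [-Complex.real_smul] <;>
    rw [covector_apply] <;> simp [vecA, vecP, vecQ]
  · ring
  · exact Or.inl (by ring)
  · exact Or.inl (by ring)

theorem covector_leftCoordDeriv (u : CoordBR) (v : Fib) (ξ : CoordBR →L[ℝ] ℝ) :
    ξ (leftCoordDeriv u vecA v) = v.1.1 * ξ vecA
        - (u.2.1.1 ^ 2)⁻¹ * (v.1.2.re * ξ vecP + v.1.2.im * ξ vecQ) ∧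
      ξ (leftCoordDeriv u vecP v) = v.1.1 * ξ vecP ∧
      ξ (leftCoordDeriv u vecQ v) = v.1.1 * ξ vecQ := by
  refine ⟨?_, ?_, ?_⟩ <;> rw [leftCoordDeriv, covector_apply] <;>
    simp [vecA, vecP, vecQ, -Complex.real_smul, Complex.smul_re, Complex.smul_im]
  ring

/-- The second derivatives of `F` and `G` cancel, as in any Lie derivative of a bivector. The
derivative of the section `X` drops out too, because the bivector has no component along `y`. For
`Ĵ₀` the sign is visible directly: `2 ∂/∂y` takes the coefficient of `∂q ∧ ∂p` to `-a⁻² / 2`, while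
`2 Ĵ₂ ∧ Ĵ₃` translates to `(a⁻² / 2) ∂q ∧ ∂p`. -/
theorem bracketCoord_variation {F G : CoordBR → ℝ} (hF : ContDiffOn ℝ ∞ F domBR)
    (hG : ContDiffOn ℝ ∞ G domBR) (X : SecBR) {u : CoordBR} (hu : u ∈ domBR)
    {α β : Fib →L[ℝ] ℝ} (hα : ∀ v, α v = fderiv ℝ F u (leftCoord u v))
    (hβ : ∀ v, β v = fderiv ℝ G u (leftCoord u v)) :
    fderiv ℝ (bracketCoord F G) u (fieldCoord X u)
        - bracketCoord (fun s => fderiv ℝ F s (fieldCoord X s)) G u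
        - bracketCoord F (fun s => fderiv ℝ G s (fieldCoord X s)) u
      = -cobracketBR X u.2.2 α β := by
  have hu0 : u.2.1.1 ≠ 0 := ne_of_gt hu
  have hl := covector_leftCoord u
  have hd := covector_leftCoordDeriv u (X u.2.2)
  have e : vecA.2.2 = 0 ∧ vecP.2.2 = 0 ∧ vecQ.2.2 = 0 := ⟨rfl, rfl, rfl⟩
  rw [fderiv_bracketCoord hF hG hu, bracketCoord, bracketCoord, cobracketBR_apply]
  simp only [bivCoord, fderiv_along_fieldCoord hF X hu, fderiv_along_fieldCoord hG X hu, e,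
    zero_smul, add_zero, (hd _).1, (hd _).2.1, (hd _).2.2, hα, hβ, (hl _).1, (hl _).2.1, (hl _).2.2]
  simp [bivCoordDeriv, coeffBR, fieldCoord, leftCoord, -Complex.real_smul, Complex.smul_re,
    Complex.smul_im]
  field_simp
  ring

theorem bivectorVariation_leftFrame (X : SecBR) (f g : C^∞⟮modelBR, BR; ℝ⟯) (p : BR) :
    bivectorVariation bivectorBR (translate groupoidBR leftFrame X) f g p
      = -cobracketBR X p.2.2 ((differential modelBR f p).comp (leftFrame p))
          ((differential modelBR g p).comp (leftFrame p)) := by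
  obtain ⟨F, hF, hf⟩ := exists_comp_coordBR f
  obtain ⟨G, hG, hg⟩ := exists_comp_coordBR g
  rw [hf, hg, bivectorVariation, differential_along_fieldCoord hF, differential_along_fieldCoord hG,
    poissonBracket_comp_coordBR hF hG,
    poissonBracket_comp_coordBR (contDiffOn_along_fieldCoord hF X) hG,
    poissonBracket_comp_coordBR hF (contDiffOn_along_fieldCoord hG X),
    differential_comp_coordBR (contDiffOn_bracketCoord hF hG), translate_leftFrame]
  refine bracketCoord_variation hF hG X (coordBR_mem p) (fun v => ?_) (fun v => ?_)
  · refine (congrArg (differential modelBR (F ∘ coordBR) p) (leftFrame_eq p v)).trans ?_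
    rw [differential_comp_coordBR hF]
    rfl
  · refine (congrArg (differential modelBR (G ∘ coordBR) p) (leftFrame_eq p v)).trans ?_
    rw [differential_comp_coordBR hG]
    rfl

/-! ### Complex conjugation and the change of sign -/

/-- Complex conjugation of sections. -/
def conjSection (X : SecBR) : SecBR :=
  ⟨fun y => conjFib (X y), (conjFib.contDiff.comp (contDiff_section X)).contMDiff⟩

theorem conjSection_apply (X : SecBR) (y : ℝ) : conjSection X y = conjFib (X y) := rfl

theorem conjFib_apply (v : Fib) : conjFib v = ((v.1.1, (starRingEnd ℂ) v.1.2), v.2) := rfl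

theorem conjFib_conjFib (v : Fib) : conjFib (conjFib v) = v := by
  simp [conjFib_apply]

theorem deriv_conjSection (X : SecBR) (y : ℝ) : deriv (conjSection X) y = conjFib (deriv X y) :=
  (conjFib.hasFDerivAt.comp_hasDerivAt y (hasDerivAt_section X y)).deriv

theorem conjSection_bracketBR (X Y : SecBR) :
    conjSection (bracketBR X Y) = bracketBR (conjSection X) (conjSection Y) := by
  ext y : 1
  simp only [conjSection_apply, bracketBR_apply, deriv_conjSection, bBracket_eq, conjFib_apply]
  refine Prod.ext (Prod.ext ?_ (Complex.ext ?_ ?_)) ?_ <;> simp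

/-- In each formula for the cobracket of a basis section, `Ĵ₂` occurs exactly once, on the left or
on the right. Reversing `Ĵ₂` therefore reverses the cobracket. -/
theorem cobracketBR_conjSection (X : SecBR) (y : ℝ) (ξ η : Fib →L[ℝ] ℝ) :
    cobracketBR (conjSection X) y ξ η
      = -cobracketBR X y (ξ.comp conjFib) (η.comp conjFib) := by
  have e1 : conjFib (hatJ 1) = hatJ 1 := by simp [conjFib_apply, hatJ]
  have e2 : conjFib (hatJ 2) = -hatJ 2 := by simp [conjFib_apply, hatJ, neg_div, map_ofNat]
  have e3 : conjFib (hatJ 3) = hatJ 3 := by simp [conjFib_apply, hatJ, map_ofNat]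
  simp only [cobracketBR_apply, ContinuousLinearMap.comp_apply, e1, e2, e3, conjSection_apply,
    conjFib_apply, map_neg, Complex.conj_re, Complex.conj_im]
  ring

theorem translate_conjLeftFrame (X : SecBR) :
    translate groupoidBR conjLeftFrame X = translate groupoidBR leftFrame (conjSection X) := rfl

theorem isLieAlgebroidOf_conjLeftFrame :
    IsLieAlgebroidOf groupoidBR algebroidBR conjLeftFrame where
  injective p := (isLieAlgebroidOf_leftFrame.injective p).comp
    (Function.LeftInverse.injective conjFib_conjFib)
  range_eq p v := by
    rw [← isLieAlgebroidOf_leftFrame.range_eq]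
    exact ⟨fun ⟨m, h⟩ => ⟨conjFib m, h⟩,
      fun ⟨m, h⟩ => ⟨conjFib m, (congrArg (leftFrame p) (conjFib_conjFib m)).trans h⟩⟩
  leftInvariant X := isLeftInvariant_translate_leftFrame (conjSection X)
  anchor_eq p v := isLieAlgebroidOf_leftFrame.anchor_eq p (conjFib v)
  bracket_eq X Y p := by
    have h : algebroidBR.bracket (conjSection X) (conjSection Y)
        = conjSection (algebroidBR.bracket X Y) := (conjSection_bracketBR X Y).symm
    rw [translate_conjLeftFrame, translate_conjLeftFrame, translate_conjLeftFrame, ← h]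
    exact isLieAlgebroidOf_leftFrame.bracket_eq _ _ p

theorem isLieBialgebroidOf_conjLeftFrame :
    IsLieBialgebroidOf groupoidBR bivectorBR algebroidBR dualAlgebroidBR conjLeftFrame where
  isLieAlgebroidOf := isLieAlgebroidOf_conjLeftFrame
  cobracket_eq X f g p := by
    rw [translate_conjLeftFrame, bivectorVariation_leftFrame, cobracketBR_conjSection, neg_neg]
    rfl
  cobracket_fun h g p := by
    obtain ⟨G, hG, hg⟩ := exists_comp_coordBR g
    have hh : ContDiff ℝ ∞ h := h.contMDiff.contDiff
    have hh' : ContDiffOn ℝ ∞ (fun u : CoordBR => h u.2.2) domBR := by fun_prop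
    have e : (fun q => h (groupoidBR.tgt q)) = (fun u : CoordBR => h u.2.2) ∘ coordBR := rfl
    -- Functions of the target are Casimirs, as the bivector has no component along `y`; this
    -- matches the zero anchor of the dual.
    have hd : ∀ v : CoordBR, v.2.2 = 0 →
        fderiv ℝ (fun u : CoordBR => h u.2.2) (coordBR p) v = 0 := by
      intro v hv
      have := ((hh.differentiable (by simp)) (coordBR p).2.2).hasFDerivAt.comp (coordBR p)
        ((ContinuousLinearMap.snd ℝ _ ℝ).comp
          (ContinuousLinearMap.snd ℝ ℝ ((ℝ × ℂ) × ℝ))).hasFDerivAt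
      refine (congrArg (fun K : CoordBR →L[ℝ] ℝ => K v) this.fderiv).trans ?_
      simp [hv]
    have h0 : differential 𝓘(ℝ, ℝ) h (groupoidBR.tgt p) (dualAlgebroidBR.anchor
        (groupoidBR.tgt p) ((differential modelBR g p).comp (conjLeftFrame p))) = 0 := map_zero _
    rw [h0, e, hg, poissonBracket_comp_coordBR hG hh']
    simp [bracketCoord, bivCoord, hd vecA rfl, hd vecP rfl, hd vecQ rfl]

end ContractionGroupoid

theorem mainTheorem1 :
    -- `ℝ × B × ℝ` with the bivector field is a Poisson groupoid
    ContractionGroupoid.IsPoissonGroupoid ContractionGroupoid.modelBR 𝓘(ℝ, ℝ)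
        ContractionGroupoid.groupoidBR ContractionGroupoid.bivectorBR ∧
    -- `𝔟 ⊕ T ℝ` is a Lie bialgebroid, with the following cobracket
    ContractionGroupoid.IsLieBialgebroid ContractionGroupoid.algebroidBR
        ContractionGroupoid.dualAlgebroidBR ∧
    (∀ (X X' : ContractionGroupoid.SecBR) (f : C^∞⟮𝓘(ℝ, ℝ), ℝ; ℝ⟯) (y : ℝ),
      ContractionGroupoid.cobracketBR (X + f • X') y
        = ContractionGroupoid.cobracketBR X y + f y • ContractionGroupoid.cobracketBR X' y) ∧
    (∀ y : ℝ,
      ContractionGroupoid.cobracketBR (ContractionGroupoid.secJ 0) y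
        = (2 : ℝ) • ContractionGroupoid.wedge (ContractionGroupoid.hatJ 2)
            (ContractionGroupoid.hatJ 3) ∧
      ContractionGroupoid.cobracketBR (ContractionGroupoid.secJ 1) y
        = (2 * y) • ContractionGroupoid.wedge (ContractionGroupoid.hatJ 2)
            (ContractionGroupoid.hatJ 3) ∧
      ContractionGroupoid.cobracketBR (ContractionGroupoid.secJ 2) y
        = (2 : ℝ) • ContractionGroupoid.wedge (ContractionGroupoid.hatJ 3)
            (ContractionGroupoid.hatJ 1) ∧
      ContractionGroupoid.cobracketBR (ContractionGroupoid.secJ 3) y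
        = (2 : ℝ) • ContractionGroupoid.wedge (ContractionGroupoid.hatJ 1)
            (ContractionGroupoid.hatJ 2)) ∧
    -- it is the Lie bialgebroid of this Poisson groupoid, through complex conjugation on `𝔟`
    -- followed by left translation
    ContractionGroupoid.IsLieBialgebroidOf ContractionGroupoid.groupoidBR
        ContractionGroupoid.bivectorBR ContractionGroupoid.algebroidBR
        ContractionGroupoid.dualAlgebroidBR ContractionGroupoid.conjLeftFrame ∧
    -- through left translation itself, the Lie algebroid of the groupoid is `𝔟 ⊕ T ℝ`, and the
    -- cobracket of the Poisson groupoid is the opposite of the above one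
    ContractionGroupoid.IsLieAlgebroidOf ContractionGroupoid.groupoidBR
        ContractionGroupoid.algebroidBR ContractionGroupoid.leftFrame ∧
    (∀ (X : ContractionGroupoid.SecBR)
        (f g : C^∞⟮ContractionGroupoid.modelBR, ContractionGroupoid.BR; ℝ⟯)
        (p : ContractionGroupoid.BR),
      ContractionGroupoid.bivectorVariation ContractionGroupoid.bivectorBR
          (ContractionGroupoid.translate ContractionGroupoid.groupoidBR
            ContractionGroupoid.leftFrame X) f g p
        = -ContractionGroupoid.cobracketBR X p.2.2
            ((ContractionGroupoid.differential ContractionGroupoid.modelBR f p).comp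
              (ContractionGroupoid.leftFrame p))
            ((ContractionGroupoid.differential ContractionGroupoid.modelBR g p).comp
              (ContractionGroupoid.leftFrame p))) := by
  exact ⟨ContractionGroupoid.isPoissonGroupoid_BR, ContractionGroupoid.isLieBialgebroid_BR,
    ContractionGroupoid.cobracketBR_linear, ContractionGroupoid.cobracketBR_secJ,
    ContractionGroupoid.isLieBialgebroidOf_conjLeftFrame,
    ContractionGroupoid.isLieAlgebroidOf_leftFrame,
    ContractionGroupoid.bivectorVariation_leftFrame⟩
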